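/- Let $S$ be a smooth oriented immersed surface in $\mathbb R^3$ without umbilic points, with principal curvatures $k_1>k_2$ and smooth unit principal vector fields $X_1,X_2$. Put $\mu=(k_1-k_2)/2$ and let $\theta_i=\mu^{-2}X_i(k_i)$, $i=1,2$, be its conformal principal curvatures. Assume that $\theta_1,\theta_2$ have no common zero on $S$, let $$V=\sqrt[3]{\theta_2}\,X_1-\sqrt[3]{\theta_1}\,X_2,$$ and let the Dupin foliation $\mathcal O$ be the foliation of $S$ by the curves tangent to $V$. A Darboux line on $S$ is a regular curve on $S$ whose osculating sphere (or plane) is tangent to $S$ at each point of the curve. Then: 1. Through every point of $S$ with $\theta_1\theta_2\neq0$ there passes a leaf of $\mathcal O$, and at every such point the leaf is tangent to some Darboux line, whose direction there is not principal. 2. Let a leaf of $\mathcal O$ and a Darboux line $\gamma$ meet at a point $p$ at which the direction of $\gamma$ is not principal. Then they are tangent at $p$ if and only if $p$ is a critical point, along $\gamma$, of the angle $\alpha$ between $\gamma$ and the principal directions of $S$. 3. If they are tangent at $p$ and, generically, $V(\log|\theta_1|-\log|\theta_2|)\neq0$ at $p$, then $\alpha$, as a function along $\gamma$, has a (strict)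 local extremum at $p$. -/

import Mathlib

open Set Filter Topology
open scoped Manifold ContDiff InnerProductSpace

noncomputable section

/-- Euclidean three-space. -/
abbrev E3 : Type := EuclideanSpace ℝ (Fin 3)

/-- The real cube root, `cbrt x ^ 3 = x` for every real `x` (odd, of either sign). -/
def cbrt (x : ℝ) : ℝ := Real.sign x * |x| ^ (1 / 3 : ℝ)

/-- A smooth oriented surface in Euclidean three-space: a smooth immersion `ι` of a smooth
two-dimensional manifold, with a smooth field `N` of unit normals. -/
structure OrientedSurface (M : Type*) [TopologicalSpace M]
    [ChartedSpace (EuclideanSpace ℝ (Fin 2)) M] where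
  ι : M → E3
  N : M → E3
  smooth_ι : ContMDiff (𝓡 2) 𝓘(ℝ, E3) ∞ ι
  smooth_N : ContMDiff (𝓡 2) 𝓘(ℝ, E3) ∞ N
  immersion : ∀ p : M, Function.Injective (mfderiv (𝓡 2) 𝓘(ℝ, E3) ι p)
  norm_N : ∀ p : M, ‖N p‖ = 1
  normal : ∀ (p : M) (v : TangentSpace (𝓡 2) p),
    inner ℝ (N p) (mfderiv (𝓡 2) 𝓘(ℝ, E3) ι p v : E3) = 0

/-- A generalized sphere (a round sphere or a plane), given as the zero set of
`x ↦ a * ‖x‖ ^ 2 - 2 * ⟪b, x⟫ + d`. The condition `a * d < ‖b‖ ^ 2` says that the zero set is a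
sphere of positive radius (if `a ≠ 0`) or a plane (if `a = 0`). -/
structure GenSphere where
  a : ℝ
  b : E3
  d : ℝ
  nondeg : a * d < ‖b‖ ^ 2

/-- The function whose zero set is the generalized sphere. -/
def GenSphere.eqn (σ : GenSphere) (x : E3) : ℝ :=
  σ.a * ‖x‖ ^ 2 - 2 * inner ℝ σ.b x + σ.d

/-- `σ` is an osculating sphere at the parameter `t` of the space curve `c`: it passes through
`c t` and has contact of order (at least) three with `c` there. -/
def GenSphere.Osculates (σ : GenSphere) (c : ℝ → E3) (t : ℝ) : Prop :=
  ∀ j : ℕ, j ≤ 3 → iteratedDeriv j (σ.eqn ∘ c) t = 0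

namespace OrientedSurface

variable {M : Type*} [TopologicalSpace M] [ChartedSpace (EuclideanSpace ℝ (Fin 2)) M]

/-- The differential of the immersion: a tangent vector of the surface as a vector in space. -/
def push (S : OrientedSurface M) (p : M) (v : TangentSpace (𝓡 2) p) : E3 :=
  mfderiv (𝓡 2) 𝓘(ℝ, E3) S.ι p v

/-- The differential of the unit normal field. -/
def dN (S : OrientedSurface M) (p : M) (v : TangentSpace (𝓡 2) p) : E3 :=
  mfderiv (𝓡 2) 𝓘(ℝ, E3) S.N p v

/-- The generalized sphere `σ` is tangent to the surface at `p`: it passes through the point, and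
its normal `a • x - b` there is orthogonal to the tangent plane of the surface. -/
def TangentSphere (S : OrientedSurface M) (σ : GenSphere) (p : M) : Prop :=
  σ.eqn (S.ι p) = 0 ∧
    ∀ v : TangentSpace (𝓡 2) p, inner ℝ (σ.a • S.ι p - σ.b) (S.push p v) = 0

/-- The velocity, as a vector in space, of a curve on the surface. -/
def vel (S : OrientedSurface M) (γ : ℝ → M) (t : ℝ) : E3 := deriv (S.ι ∘ γ) t

/-- `γ` is a regular curve of class `C^n` on the surface, with parameter in the open
interval `J`. -/
def IsRegularCurve (S : OrientedSurface M) (n : WithTop ℕ∞) (γ : ℝ → M) (J : Set ℝ) : Prop :=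
  IsOpen J ∧ J.OrdConnected ∧ ContMDiffOn 𝓘(ℝ, ℝ) (𝓡 2) n γ J ∧ ∀ t ∈ J, S.vel γ t ≠ 0

/-- Darboux lines: smooth regular curves on the surface whose osculating sphere is, at every
point, tangent to the surface. -/
def IsDarbouxLine (S : OrientedSurface M) (γ : ℝ → M) (J : Set ℝ) : Prop :=
  S.IsRegularCurve ∞ γ J ∧
    ∀ t ∈ J, ∃ σ : GenSphere, σ.Osculates (S.ι ∘ γ) t ∧ S.TangentSphere σ (γ t)

/-- Two curves on the surface are tangent at the parameters `s`, `t`: they meet there and their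
velocities span the same line. -/
def TangentAt (S : OrientedSurface M) (δ γ : ℝ → M) (s t : ℝ) : Prop :=
  δ s = γ t ∧ ∃ r : ℝ, r ≠ 0 ∧ S.vel γ t = r • S.vel δ s

/-- Unit principal vector fields `X₁`, `X₂` on an umbilic free surface, for the principal
curvatures `k₁ > k₂` (eigenvalues of the shape operator `-dN`). Since `ι` is an immersion, a
tangent field is smooth exactly when it is smooth as a field of vectors in space. -/
structure PrincipalFrame (S : OrientedSurface M) where
  k₁ : M → ℝ
  k₂ : M → ℝ
  X₁ : ∀ p : M, TangentSpace (𝓡 2) p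
  X₂ : ∀ p : M, TangentSpace (𝓡 2) p
  smooth_X₁ : ContMDiff (𝓡 2) 𝓘(ℝ, E3) ∞ (fun p => S.push p (X₁ p))
  smooth_X₂ : ContMDiff (𝓡 2) 𝓘(ℝ, E3) ∞ (fun p => S.push p (X₂ p))
  unit_X₁ : ∀ p, ‖S.push p (X₁ p)‖ = 1
  unit_X₂ : ∀ p, ‖S.push p (X₂ p)‖ = 1
  eigen₁ : ∀ p, S.dN p (X₁ p) = -(k₁ p • S.push p (X₁ p))
  eigen₂ : ∀ p, S.dN p (X₂ p) = -(k₂ p • S.push p (X₂ p))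
  umbilic_free : ∀ p, k₂ p < k₁ p

end OrientedSurface

/-- The derivative of a function on the surface along a vector field. -/
def dirDeriv {M : Type*} [TopologicalSpace M] [ChartedSpace (EuclideanSpace ℝ (Fin 2)) M]
    (X : ∀ p : M, TangentSpace (𝓡 2) p) (f : M → ℝ) (p : M) : ℝ :=
  mfderiv (𝓡 2) 𝓘(ℝ, ℝ) f p (X p)

namespace OrientedSurface.PrincipalFrame

variable {M : Type*} [TopologicalSpace M] [ChartedSpace (EuclideanSpace ℝ (Fin 2)) M]
  {S : OrientedSurface M}

/-- Half the difference of the principal curvatures. -/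
def μ (F : S.PrincipalFrame) (p : M) : ℝ := (F.k₁ p - F.k₂ p) / 2

/-- The first conformal principal curvature. -/
def θ₁ (F : S.PrincipalFrame) (p : M) : ℝ := 1 / F.μ p ^ 2 * dirDeriv F.X₁ F.k₁ p

/-- The second conformal principal curvature. -/
def θ₂ (F : S.PrincipalFrame) (p : M) : ℝ := 1 / F.μ p ^ 2 * dirDeriv F.X₂ F.k₂ p

/-- The vector field spanning the Dupin foliation: its direction `x X₁ + y X₂` is the one with
`θ₁ x ^ 3 + θ₂ y ^ 3 = 0`, in which some Dupin cyclide is tangent to the surface of order three. -/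
def V (F : S.PrincipalFrame) (p : M) : TangentSpace (𝓡 2) p :=
  cbrt (F.θ₂ p) • F.X₁ p - cbrt (F.θ₁ p) • F.X₂ p

/-- No Dupin points: the conformal principal curvatures never vanish simultaneously. -/
def NoDupinPoints (F : S.PrincipalFrame) : Prop := ∀ p, F.θ₁ p ≠ 0 ∨ F.θ₂ p ≠ 0

/-- Dupin lines (leaves, or pieces of leaves, of the Dupin foliation): regular curves tangent
to `V` everywhere. As `V` is in general only continuous, they are only asked to be `C^1`. -/
def IsDupinLine (F : S.PrincipalFrame) (δ : ℝ → M) (K : Set ℝ) : Prop :=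
  S.IsRegularCurve 1 δ K ∧ ∀ s ∈ K, ∃ r : ℝ, S.vel δ s = r • S.push (δ s) (F.V (δ s))

/-- The curve `γ` has at `t` a direction different from both principal directions. -/
def NonPrincipalAt (F : S.PrincipalFrame) (γ : ℝ → M) (t : ℝ) : Prop :=
  ∀ r : ℝ, S.vel γ t ≠ r • S.push (γ t) (F.X₁ (γ t)) ∧
    S.vel γ t ≠ r • S.push (γ t) (F.X₂ (γ t))

end OrientedSurface.PrincipalFrame

/-- The angle, in `[0, π]`, between the curve `γ` and the vector field `X` along the curve. -/
def OrientedSurface.angleAlong {M : Type*} [TopologicalSpace M]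
    [ChartedSpace (EuclideanSpace ℝ (Fin 2)) M] (S : OrientedSurface M)
    (X : ∀ p : M, TangentSpace (𝓡 2) p) (γ : ℝ → M) (t : ℝ) : ℝ :=
  InnerProductGeometry.angle (S.vel γ t) (S.push (γ t) (X (γ t)))

/-- `f` has a strict local extremum at `t`. -/
def IsStrictLocalExtremum (f : ℝ → ℝ) (t : ℝ) : Prop :=
  (∀ᶠ u in 𝓝[≠] t, f u < f t) ∨ (∀ᶠ u in 𝓝[≠] t, f t < f u)

end

section Calculus

variable {V W : Type*} [NormedAddCommGroup V] [NormedSpace ℝ V]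
  [NormedAddCommGroup W] [NormedSpace ℝ W]

theorem fderiv_fderiv_apply_field {f : V → W} {a : V → V} {x : V} (hf : ContDiffAt ℝ 2 f x)
    (ha : DifferentiableAt ℝ a x) (v : V) :
    fderiv ℝ (fun y => fderiv ℝ f y (a y)) x v =
      fderiv ℝ (fderiv ℝ f) x v (a x) + fderiv ℝ f x (fderiv ℝ a x v) := by
  have hd : DifferentiableAt ℝ (fderiv ℝ f) x :=
    (hf.fderiv_right (m := 1) (by norm_num)).differentiableAt (by norm_num)
  rw [fderiv_clm_apply hd ha]
  simp [add_comm]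

/-- The derivative of `f` along the bracket of two vector fields. -/
theorem fderiv_bracket {f : V → W} {a b : V → V} {x : V} (hf : ContDiffAt ℝ 2 f x)
    (ha : DifferentiableAt ℝ a x) (hb : DifferentiableAt ℝ b x) :
    fderiv ℝ f x (fderiv ℝ a x (b x) - fderiv ℝ b x (a x)) =
      fderiv ℝ (fun y => fderiv ℝ f y (a y)) x (b x) -
        fderiv ℝ (fun y => fderiv ℝ f y (b y)) x (a x) := by
  have hs : IsSymmSndFDerivAt ℝ f x := hf.isSymmSndFDerivAt (by simp)
  rw [fderiv_fderiv_apply_field hf ha, fderiv_fderiv_apply_field hf hb, map_sub,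
    hs.eq (a x) (b x)]
  abel

/-- A critical point with nonzero second derivative is a strict local extremum. -/
theorem isStrictLocalExtremum_of_hasDerivAt {f g : ℝ → ℝ} {t L : ℝ}
    (hf : ∀ᶠ u in 𝓝 t, HasDerivAt f (g u) u) (hgt : g t = 0) (hg : HasDerivAt g L t)
    (hL : L ≠ 0) : IsStrictLocalExtremum f t := by
  have key : ∀ f g : ℝ → ℝ, ∀ L : ℝ, (∀ᶠ u in 𝓝 t, HasDerivAt f (g u) u) → g t = 0 →
      HasDerivAt g L t → 0 < L → ∀ᶠ u in 𝓝[≠] t, f t < f u := by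
    intro f g L hf hgt hg hL
    have h1 : ∀ᶠ u in 𝓝[≠] t, 0 < slope g t u :=
      (hasDerivAt_iff_tendsto_slope.1 hg).eventually (lt_mem_nhds hL)
    rw [eventually_nhdsWithin_iff] at h1
    obtain ⟨ε, hε, hball⟩ := Metric.eventually_nhds_iff_ball.1 (hf.and h1)
    rw [eventually_nhdsWithin_iff]
    filter_upwards [Metric.ball_mem_nhds t hε] with u hu hne
    have hseg : ∀ s ∈ uIcc t u, s ∈ Metric.ball t ε := fun s hs =>
      (convex_ball t ε).ordConnected.uIcc_subset (Metric.mem_ball_self hε) hu hs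
    have hpos : ∀ s ∈ Metric.ball t ε, s ≠ t → 0 < (s - t) * g s := by
      intro s hs hst
      have := (hball s hs).2 hst
      rw [slope_def_field, hgt, sub_zero] at this
      have h2 : 0 < (s - t) ^ 2 := by positivity [sub_ne_zero.2 hst]
      have h3 : (s - t) * g s = (s - t) ^ 2 * (g s / (s - t)) := by
        field_simp [sub_ne_zero.2 hst]
      rw [h3]; positivity
    rcases lt_or_gt_of_ne (show u ≠ t from hne) with h | h
    · have hs : ∀ s ∈ Icc u t, s ∈ Metric.ball t ε := fun s hs =>
        hseg s (by rwa [uIcc_of_ge h.le])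
      refine strictAntiOn_of_deriv_neg (convex_Icc u t)
        (fun s h' => (hball s (hs s h')).1.continuousAt.continuousWithinAt) ?_
        (left_mem_Icc.2 h.le) (right_mem_Icc.2 h.le) h
      intro s h'
      rw [interior_Icc] at h'
      have h'' := hs s (Ioo_subset_Icc_self h')
      rw [(hball s h'').1.deriv]
      have := hpos s h'' h'.2.ne
      have := h'.2
      nlinarith
    · have hs : ∀ s ∈ Icc t u, s ∈ Metric.ball t ε := fun s hs =>
        hseg s (by rwa [uIcc_of_le h.le])
      refine strictMonoOn_of_deriv_pos (convex_Icc t u)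
        (fun s h' => (hball s (hs s h')).1.continuousAt.continuousWithinAt) ?_
        (left_mem_Icc.2 h.le) (right_mem_Icc.2 h.le) h
      intro s h'
      rw [interior_Icc] at h'
      have h'' := hs s (Ioo_subset_Icc_self h')
      rw [(hball s h'').1.deriv]
      have := hpos s h'' h'.1.ne'
      have := h'.1
      nlinarith
  rcases lt_or_gt_of_ne hL with h | h
  · left
    have := key (fun u => -f u) (fun u => -g u) (-L) (hf.mono fun u hu => hu.neg) (by simp [hgt])
      hg.neg (by linarith)
    simpa using this
  · exact Or.inr (key f g L hf hgt hg h)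

theorem contDiffOn_of_hasDerivAt_autonomous {f : V → V} {Ω : Set V}
    (hf : ContDiffOn ℝ ∞ f Ω) {J : Set ℝ} (hJ : IsOpen J) {y : ℝ → V}
    (hy : ∀ t ∈ J, y t ∈ Ω ∧ HasDerivAt y (f (y t)) t) : ContDiffOn ℝ ∞ y J := by
  rw [contDiffOn_infty]
  have hd : DifferentiableOn ℝ y J := fun t ht =>
    (hy t ht).2.differentiableAt.differentiableWithinAt
  intro n
  induction n with
  | zero => exact contDiffOn_zero.2 hd.continuousOn
  | succ n ih =>
    rw [Nat.cast_succ, contDiffOn_succ_iff_deriv_of_isOpen hJ]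
    refine ⟨hd, by simp, ?_⟩
    have : ContDiffOn ℝ n (f ∘ y) J :=
      (hf.of_le (by exact_mod_cast le_top)).comp ih fun t ht => (hy t ht).1
    exact this.congr fun t ht => (hy t ht).2.deriv

/-- Local existence of smooth integral curves of a smooth vector field. -/
theorem exists_smooth_integralCurve [CompleteSpace V] {f : V → V} {Ω : Set V} (hΩ : IsOpen Ω)
    (hf : ContDiffOn ℝ ∞ f Ω) {x : V} (hx : x ∈ Ω) :
    ∃ (y : ℝ → V) (J : Set ℝ), IsOpen J ∧ J.OrdConnected ∧ (0 : ℝ) ∈ J ∧ y 0 = x ∧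
      (∀ t ∈ J, y t ∈ Ω ∧ HasDerivAt y (f (y t)) t) ∧ ContDiffOn ℝ ∞ y J := by
  have hfx : ContDiffAt ℝ 1 f x :=
    (hf.contDiffAt (hΩ.mem_nhds hx)).of_le (by exact_mod_cast le_top)
  obtain ⟨y, hy0, ε, hε, hy⟩ :=
    hfx.exists_forall_mem_closedBall_exists_eq_forall_mem_Ioo_hasDerivAt₀ 0
  have hc : ContinuousAt y 0 := (hy 0 (by simp [hε])).continuousAt
  obtain ⟨δ, hδ, hball⟩ := Metric.eventually_nhds_iff_ball.1
    (hc.eventually (hΩ.mem_nhds (by rwa [hy0])))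
  have hJ : ∀ t ∈ Ioo (-min ε δ) (min ε δ), y t ∈ Ω ∧ HasDerivAt y (f (y t)) t := by
    intro t ht
    have h1 := min_le_left ε δ
    have h2 := min_le_right ε δ
    refine ⟨hball t ?_, hy t ⟨by linarith [ht.1], by linarith [ht.2]⟩⟩
    rw [Real.ball_eq_Ioo]
    exact ⟨by linarith [ht.1], by linarith [ht.2]⟩
  exact ⟨y, Ioo (-min ε δ) (min ε δ), isOpen_Ioo, ordConnected_Ioo, by simp [hε, hδ], hy0, hJ,
    contDiffOn_of_hasDerivAt_autonomous hf isOpen_Ioo hJ⟩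

end Calculus

theorem orthonormal_expansion {e₁ e₂ e₃ : E3} (h₁ : ‖e₁‖ = 1) (h₂ : ‖e₂‖ = 1) (h₃ : ‖e₃‖ = 1)
    (h₁₂ : inner ℝ e₁ e₂ = 0) (h₁₃ : inner ℝ e₁ e₃ = 0) (h₂₃ : inner ℝ e₂ e₃ = 0) (x : E3) :
    x = inner ℝ e₁ x • e₁ + inner ℝ e₂ x • e₂ + inner ℝ e₃ x • e₃ := by
  have ho : Orthonormal ℝ ![e₁, e₂, e₃] := by
    refine ⟨fun i => by fin_cases i <;> assumption, fun i j hij => ?_⟩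
    fin_cases i <;> fin_cases j <;>
      simp_all [real_inner_comm]
  let b := basisOfOrthonormalOfCardEqFinrank ho (by simp)
  have hb : ⇑b = ![e₁, e₂, e₃] := coe_basisOfOrthonormalOfCardEqFinrank ho (by simp)
  let B := b.toOrthonormalBasis (by rw [hb]; exact ho)
  have hB : ⇑B = ![e₁, e₂, e₃] := by simp [B, hb]
  have := B.sum_repr' x
  rw [Fin.sum_univ_three, hB] at this
  simpa using this.symm

/-- A parametrized surface patch `r` with unit normal `N`, principal directions `a₁`, `a₂` (as
vector fields on the parameter domain `U`) and principal curvatures `k₂ < k₁`. -/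
structure IsPrincipalPatch (U : Set (EuclideanSpace ℝ (Fin 2)))
    (r N : EuclideanSpace ℝ (Fin 2) → E3)
    (a₁ a₂ : EuclideanSpace ℝ (Fin 2) → EuclideanSpace ℝ (Fin 2))
    (k₁ k₂ : EuclideanSpace ℝ (Fin 2) → ℝ) : Prop where
  isOpen : IsOpen U
  smooth_r : ContDiffOn ℝ ∞ r U
  smooth_N : ContDiffOn ℝ ∞ N U
  smooth_a₁ : ContDiffOn ℝ ∞ a₁ U
  smooth_a₂ : ContDiffOn ℝ ∞ a₂ U
  smooth_k₁ : ContDiffOn ℝ ∞ k₁ U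
  smooth_k₂ : ContDiffOn ℝ ∞ k₂ U
  injective : ∀ x ∈ U, Function.Injective (fderiv ℝ r x)
  norm_N : ∀ x ∈ U, ‖N x‖ = 1
  normal : ∀ x ∈ U, ∀ v, inner ℝ (N x) (fderiv ℝ r x v) = 0
  unit₁ : ∀ x ∈ U, ‖fderiv ℝ r x (a₁ x)‖ = 1
  unit₂ : ∀ x ∈ U, ‖fderiv ℝ r x (a₂ x)‖ = 1
  eigen₁ : ∀ x ∈ U, fderiv ℝ N x (a₁ x) = -(k₁ x • fderiv ℝ r x (a₁ x))
  eigen₂ : ∀ x ∈ U, fderiv ℝ N x (a₂ x) = -(k₂ x • fderiv ℝ r x (a₂ x))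
  lt : ∀ x ∈ U, k₂ x < k₁ x

/-- The shape operator is symmetric. -/
theorem inner_fderiv_normal_comm {V W : Type*} [NormedAddCommGroup V] [NormedSpace ℝ V]
    [NormedAddCommGroup W] [InnerProductSpace ℝ W] {r N : V → W} {U : Set V} (hU : IsOpen U)
    (hr : ContDiffOn ℝ ∞ r U) (hN : ContDiffOn ℝ ∞ N U)
    (hn : ∀ x ∈ U, ∀ v, inner ℝ (N x) (fderiv ℝ r x v) = 0) {x : V} (hx : x ∈ U) (v w : V) :
    inner ℝ (fderiv ℝ N x v) (fderiv ℝ r x w) = inner ℝ (fderiv ℝ N x w) (fderiv ℝ r x v) := by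
  have hr2 : ContDiffAt ℝ 2 r x :=
    (hr.contDiffAt (hU.mem_nhds hx)).of_le (WithTop.coe_le_coe.2 le_top)
  have hNx : DifferentiableAt ℝ N x :=
    (hN.contDiffAt (hU.mem_nhds hx)).differentiableAt (by simp)
  have hd : DifferentiableAt ℝ (fderiv ℝ r) x :=
    (hr2.fderiv_right (m := 1) (by norm_num)).differentiableAt (by norm_num)
  have hs : IsSymmSndFDerivAt ℝ r x := hr2.isSymmSndFDerivAt (by simp)
  have key : ∀ v w : V, inner ℝ (fderiv ℝ N x v) (fderiv ℝ r x w) =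
      -inner ℝ (N x) (fderiv ℝ (fderiv ℝ r) x v w) := by
    intro v w
    have h0 : (fun y => inner ℝ (N y) (fderiv ℝ r y w)) =ᶠ[𝓝 x] fun _ => (0 : ℝ) := by
      filter_upwards [hU.mem_nhds hx] with y hy using hn y hy w
    have hcd : DifferentiableAt ℝ (fun y => fderiv ℝ r y w) x :=
      hd.clm_apply (differentiableAt_const w)
    have h1 : fderiv ℝ (fun y => inner ℝ (N y) (fderiv ℝ r y w)) x v =
        fderiv ℝ (fun _ => (0 : ℝ)) x v := by rw [h0.fderiv_eq]
    rw [fderiv_inner_apply ℝ hNx hcd,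
      fderiv_fderiv_apply_field (a := fun _ => w) hr2 (differentiableAt_const w)] at h1
    simp at h1
    linarith
  rw [key, key, hs.eq]

namespace IsPrincipalPatch

variable {U : Set (EuclideanSpace ℝ (Fin 2))} {r N : EuclideanSpace ℝ (Fin 2) → E3}
    {a₁ a₂ : EuclideanSpace ℝ (Fin 2) → EuclideanSpace ℝ (Fin 2)}
    {k₁ k₂ : EuclideanSpace ℝ (Fin 2) → ℝ} {x : EuclideanSpace ℝ (Fin 2)}

theorem orthogonal (h : IsPrincipalPatch U r N a₁ a₂ k₁ k₂) (hx : x ∈ U) :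
    inner ℝ (fderiv ℝ r x (a₁ x)) (fderiv ℝ r x (a₂ x)) = 0 := by
  have := inner_fderiv_normal_comm h.isOpen h.smooth_r h.smooth_N h.normal hx (a₁ x) (a₂ x)
  rw [h.eigen₁ x hx, h.eigen₂ x hx, inner_neg_left, inner_neg_left, inner_smul_left,
    inner_smul_left, real_inner_comm] at this
  simp only [conj_trivial] at this
  have hne := sub_ne_zero.2 (h.lt x hx).ne
  rw [real_inner_comm]
  refine (mul_eq_zero.1 ?_).resolve_left hne
  linarith

theorem expansion (h : IsPrincipalPatch U r N a₁ a₂ k₁ k₂) (hx : x ∈ U) (z : E3) :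
    z = inner ℝ (fderiv ℝ r x (a₁ x)) z • fderiv ℝ r x (a₁ x) +
      inner ℝ (fderiv ℝ r x (a₂ x)) z • fderiv ℝ r x (a₂ x) + inner ℝ (N x) z • N x :=
  orthonormal_expansion (h.unit₁ x hx) (h.unit₂ x hx) (h.norm_N x hx) (h.orthogonal hx)
    (by rw [real_inner_comm]; exact h.normal x hx _)
    (by rw [real_inner_comm]; exact h.normal x hx _) z

theorem expansion_tangent (h : IsPrincipalPatch U r N a₁ a₂ k₁ k₂) (hx : x ∈ U)
    (v : EuclideanSpace ℝ (Fin 2)) :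
    v = inner ℝ (fderiv ℝ r x (a₁ x)) (fderiv ℝ r x v) • a₁ x +
      inner ℝ (fderiv ℝ r x (a₂ x)) (fderiv ℝ r x v) • a₂ x := by
  apply h.injective x hx
  conv_lhs => rw [h.expansion hx (fderiv ℝ r x v), h.normal x hx]
  simp

/-- The Codazzi equations in terms of the connection form of the principal frame. -/
theorem codazzi (h : IsPrincipalPatch U r N a₁ a₂ k₁ k₂) (hx : x ∈ U) :
    fderiv ℝ k₁ x (a₂ x) = (k₁ x - k₂ x) *
      inner ℝ (fderiv ℝ (fun y => fderiv ℝ r y (a₁ y)) x (a₁ x)) (fderiv ℝ r x (a₂ x)) ∧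
    fderiv ℝ k₂ x (a₁ x) = (k₁ x - k₂ x) *
      inner ℝ (fderiv ℝ (fun y => fderiv ℝ r y (a₁ y)) x (a₂ x)) (fderiv ℝ r x (a₂ x)) := by
  have hU := h.isOpen.mem_nhds hx
  have hr2 : ContDiffAt ℝ 2 r x :=
    (h.smooth_r.contDiffAt hU).of_le (WithTop.coe_le_coe.2 le_top)
  have hN2 : ContDiffAt ℝ 2 N x :=
    (h.smooth_N.contDiffAt hU).of_le (WithTop.coe_le_coe.2 le_top)
  have hd : DifferentiableAt ℝ (fderiv ℝ r) x :=
    (hr2.fderiv_right (m := 1) (by norm_num)).differentiableAt (by norm_num)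
  have ha₁ : DifferentiableAt ℝ a₁ x := (h.smooth_a₁.contDiffAt hU).differentiableAt (by simp)
  have ha₂ : DifferentiableAt ℝ a₂ x := (h.smooth_a₂.contDiffAt hU).differentiableAt (by simp)
  have hk₁ : DifferentiableAt ℝ k₁ x := (h.smooth_k₁.contDiffAt hU).differentiableAt (by simp)
  have hk₂ : DifferentiableAt ℝ k₂ x := (h.smooth_k₂.contDiffAt hU).differentiableAt (by simp)
  set E₁ := fun y => fderiv ℝ r y (a₁ y) with hE₁
  set E₂ := fun y => fderiv ℝ r y (a₂ y) with hE₂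
  have hdE₁ : DifferentiableAt ℝ E₁ x := hd.clm_apply ha₁
  have hdE₂ : DifferentiableAt ℝ E₂ x := hd.clm_apply ha₂
  have b1 : fderiv ℝ r x (fderiv ℝ a₁ x (a₂ x) - fderiv ℝ a₂ x (a₁ x)) =
      fderiv ℝ E₁ x (a₂ x) - fderiv ℝ E₂ x (a₁ x) := fderiv_bracket hr2 ha₁ ha₂
  have b2 := fderiv_bracket hN2 ha₁ ha₂
  set Z := fderiv ℝ a₁ x (a₂ x) - fderiv ℝ a₂ x (a₁ x)
  have e1 : (fun y => fderiv ℝ N y (a₁ y)) =ᶠ[𝓝 x] fun y => -(k₁ y • E₁ y) := by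
    filter_upwards [hU] with y hy using h.eigen₁ y hy
  have e2 : (fun y => fderiv ℝ N y (a₂ y)) =ᶠ[𝓝 x] fun y => -(k₂ y • E₂ y) := by
    filter_upwards [hU] with y hy using h.eigen₂ y hy
  have d1 : fderiv ℝ (fun y => -(k₁ y • E₁ y)) x (a₂ x) =
      -(k₁ x • fderiv ℝ E₁ x (a₂ x) + fderiv ℝ k₁ x (a₂ x) • E₁ x) := by
    rw [fderiv_fun_neg, fderiv_fun_smul hk₁ hdE₁]; simp
  have d2 : fderiv ℝ (fun y => -(k₂ y • E₂ y)) x (a₁ x) =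
      -(k₂ x • fderiv ℝ E₂ x (a₁ x) + fderiv ℝ k₂ x (a₁ x) • E₂ x) := by
    rw [fderiv_fun_neg, fderiv_fun_smul hk₂ hdE₂]; simp
  rw [e1.fderiv_eq, e2.fderiv_eq, d1, d2, h.expansion_tangent hx Z, map_add, map_smul, map_smul,
    h.eigen₁ x hx, h.eigen₂ x hx, b1] at b2
  have o11 : ∀ y ∈ U, inner ℝ (E₁ y) (E₁ y) = (1 : ℝ) := fun y hy => by
    rw [real_inner_self_eq_norm_sq, h.unit₁ y hy]; norm_num
  have o22 : ∀ y ∈ U, inner ℝ (E₂ y) (E₂ y) = (1 : ℝ) := fun y hy => by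
    rw [real_inner_self_eq_norm_sq, h.unit₂ y hy]; norm_num
  have o12 : ∀ y ∈ U, inner ℝ (E₁ y) (E₂ y) = (0 : ℝ) := fun y hy => h.orthogonal hy
  have deriv_const : ∀ (A B : EuclideanSpace ℝ (Fin 2) → E3) (c : ℝ), DifferentiableAt ℝ A x →
      DifferentiableAt ℝ B x → (∀ y ∈ U, inner ℝ (A y) (B y) = c) → ∀ v,
      inner ℝ (A x) (fderiv ℝ B x v) + inner ℝ (fderiv ℝ A x v) (B x) = 0 := by
    intro A B c hA hB hc v
    rw [← fderiv_inner_apply ℝ hA hB]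
    have : (fun y => inner ℝ (A y) (B y)) =ᶠ[𝓝 x] fun _ => c := by
      filter_upwards [hU] with y hy using hc y hy
    rw [this.fderiv_eq]; simp
  have p1 := deriv_const E₁ E₁ 1 hdE₁ hdE₁ o11 (a₂ x)
  have p2 := deriv_const E₂ E₂ 1 hdE₂ hdE₂ o22 (a₁ x)
  have p3 := deriv_const E₁ E₂ 0 hdE₁ hdE₂ o12 (a₁ x)
  have q1 := congrArg (fun z => inner ℝ (E₁ x) z) b2
  have q2 := congrArg (fun z => inner ℝ (E₂ x) z) b2
  have c12 := o12 x hx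
  have c21 : inner ℝ (E₂ x) (E₁ x) = (0 : ℝ) := by rw [real_inner_comm]; exact c12
  have c11 := o11 x hx
  have c22 := o22 x hx
  change _ = (k₁ x - k₂ x) * inner ℝ _ (E₂ x) ∧ _ = (k₁ x - k₂ x) * inner ℝ _ (E₂ x)
  change inner ℝ (E₁ x) (_ • -(k₁ x • E₁ x) + _ • -(k₂ x • E₂ x)) = _ at q1
  change inner ℝ (E₂ x) (_ • -(k₁ x • E₁ x) + _ • -(k₂ x • E₂ x)) = _ at q2
  simp only [inner_add_right, inner_sub_right, inner_smul_right, inner_neg_right, c11, c12, c21,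
    c22] at q1 q2
  have hE₁x : fderiv ℝ r x (a₁ x) = E₁ x := rfl
  have hE₂x : fderiv ℝ r x (a₂ x) = E₂ x := rfl
  rw [hE₁x, hE₂x] at q1 q2
  simp only [real_inner_comm (E₁ x), real_inner_comm (E₂ x)] at p1 p2 p3 q1 q2 ⊢
  generalize inner ℝ (fderiv ℝ E₁ x (a₁ x)) (E₂ x) = w1 at *
  generalize inner ℝ (fderiv ℝ E₁ x (a₂ x)) (E₂ x) = w2 at *
  constructor
  · linear_combination q1 - (k₁ x - k₂ x) * p3
  · linear_combination -q2

end IsPrincipalPatch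

theorem ContDiffAt.eventually_hasDerivAt {W : Type*} [NormedAddCommGroup W] [NormedSpace ℝ W]
    {c : ℝ → W} {t : ℝ} {n : ℕ} (hc : ContDiffAt ℝ (n + 1) c t) :
    (∀ᶠ s in 𝓝 t, HasDerivAt c (deriv c s) s) ∧ ContDiffAt ℝ n (deriv c) t := by
  constructor
  · have h1 : ContDiffAt ℝ 1 c t := hc.of_le (by simp)
    filter_upwards [h1.eventually (by simp)] with s hs
    exact (hs.differentiableAt (by simp)).hasDerivAt
  · exact hc.derivWithin (m := n) (by simp)

theorem GenSphere.osculates_iff (σ : GenSphere) {c : ℝ → E3} {t : ℝ} (hc : ContDiffAt ℝ 3 c t) :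
    σ.Osculates c t ↔ σ.eqn (c t) = 0 ∧ inner ℝ (σ.a • c t - σ.b) (deriv c t) = 0 ∧
      σ.a * inner ℝ (deriv c t) (deriv c t) +
        inner ℝ (σ.a • c t - σ.b) (deriv (deriv c) t) = 0 ∧
      3 * σ.a * inner ℝ (deriv c t) (deriv (deriv c) t) +
        inner ℝ (σ.a • c t - σ.b) (deriv (deriv (deriv c)) t) = 0 := by
  obtain ⟨h1, hc1⟩ := ContDiffAt.eventually_hasDerivAt (n := 2) (by norm_num; exact hc)
  obtain ⟨h2, hc2⟩ := ContDiffAt.eventually_hasDerivAt (n := 1) (by exact_mod_cast hc1)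
  obtain ⟨h3, -⟩ := ContDiffAt.eventually_hasDerivAt (n := 0) (by simpa using hc2)
  have hn : ∀ {s : ℝ}, HasDerivAt c (deriv c s) s →
      HasDerivAt (fun s => σ.a • c s - σ.b) (σ.a • deriv c s) s := fun h =>
    (h.const_smul σ.a).sub_const σ.b
  have d1 : deriv (σ.eqn ∘ c) =ᶠ[𝓝 t] fun s => 2 * inner ℝ (σ.a • c s - σ.b) (deriv c s) := by
    filter_upwards [h1] with s hs
    have : σ.eqn ∘ c = fun s => σ.a * inner ℝ (c s) (c s) - 2 * inner ℝ σ.b (c s) + σ.d := by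
      funext s; simp [GenSphere.eqn]
    rw [this]
    have := (((hs.inner ℝ hs).const_mul σ.a).sub
      (((hasDerivAt_const s σ.b).inner ℝ hs).const_mul 2)).add_const σ.d
    refine this.deriv.trans ?_
    rw [inner_sub_left, inner_smul_left, real_inner_comm (c s)]
    simp; ring
  have d2 : deriv (deriv (σ.eqn ∘ c)) =ᶠ[𝓝 t] fun s =>
      2 * (σ.a * inner ℝ (deriv c s) (deriv c s) +
        inner ℝ (σ.a • c s - σ.b) (deriv (deriv c) s)) := by
    filter_upwards [d1.eventuallyEq_nhds, h1, h2] with s e hs hs2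
    rw [e.deriv_eq, (((hn hs).inner ℝ hs2).const_mul 2).deriv, inner_smul_left]
    simp; ring
  have d3 : deriv (deriv (deriv (σ.eqn ∘ c))) t =
      2 * (3 * σ.a * inner ℝ (deriv c t) (deriv (deriv c) t) +
        inner ℝ (σ.a • c t - σ.b) (deriv (deriv (deriv c)) t)) := by
    have hs := h1.self_of_nhds
    have hs2 := h2.self_of_nhds
    have hs3 := h3.self_of_nhds
    rw [d2.deriv_eq]
    refine ((((hs2.inner ℝ hs2).const_mul σ.a).add
      ((hn hs).inner ℝ hs3)).const_mul 2).deriv.trans ?_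
    rw [inner_smul_left, real_inner_comm (deriv c t) (deriv (deriv c) t)]
    simp; ring
  have e1 := d1.self_of_nhds
  have e2 := d2.self_of_nhds
  simp only at e1 e2
  constructor
  · intro h
    have g0 := h 0 (by norm_num)
    have g1 := h 1 (by norm_num)
    have g2 := h 2 (by norm_num)
    have g3 := h 3 (by norm_num)
    simp only [iteratedDeriv_succ, iteratedDeriv_zero, Function.comp_apply] at g0 g1 g2 g3
    refine ⟨g0, ?_, ?_, ?_⟩ <;> linarith
  · rintro ⟨g0, g1, g2, g3⟩ j hj
    interval_cases j <;> simp only [iteratedDeriv_succ, iteratedDeriv_zero, Function.comp_apply]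
    · exact g0
    · rw [e1, g1, mul_zero]
    · rw [e2, g2, mul_zero]
    · rw [d3, g3, mul_zero]

theorem GenSphere.norm_sq_normal (σ : GenSphere) (x : E3) :
    ‖σ.a • x - σ.b‖ ^ 2 = σ.a * σ.eqn x + (‖σ.b‖ ^ 2 - σ.a * σ.d) := by
  rw [norm_sub_sq_real, norm_smul, inner_smul_left, real_inner_comm, GenSphere.eqn, mul_pow,
    Real.norm_eq_abs, sq_abs]
  simp; ring

/-- Existence of an osculating sphere of a curve with prescribed unit normal `n` at a point. -/
theorem exists_osculating_sphere_iff {c : ℝ → E3} {t : ℝ} (hc : ContDiffAt ℝ 3 c t)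
    (h0 : deriv c t ≠ 0) {n : E3} (hn : ‖n‖ = 1) (hcn : inner ℝ n (deriv c t) = 0) :
    (∃ σ : GenSphere, σ.Osculates c t ∧ σ.eqn (c t) = 0 ∧ ∃ l : ℝ, σ.a • c t - σ.b = l • n) ↔
      3 * inner ℝ n (deriv (deriv c) t) * inner ℝ (deriv c t) (deriv (deriv c) t) =
        inner ℝ (deriv c t) (deriv c t) * inner ℝ n (deriv (deriv (deriv c)) t) := by
  have hpos : inner ℝ (deriv c t) (deriv c t) ≠ (0 : ℝ) := by simpa using h0
  constructor
  · rintro ⟨σ, ho, he, l, hl⟩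
    obtain ⟨-, -, g2, g3⟩ := (σ.osculates_iff hc).1 ho
    have hl0 : l ≠ 0 := by
      rintro rfl
      have := σ.norm_sq_normal (c t)
      rw [hl, he] at this
      have := σ.nondeg
      simp_all
    rw [hl, inner_smul_left] at g2 g3
    simp only [conj_trivial] at g2 g3
    apply mul_left_cancel₀ hl0
    linear_combination 3 * inner ℝ (deriv c t) (deriv (deriv c) t) * g2
      - inner ℝ (deriv c t) (deriv c t) * g3
  · intro h
    set v := inner ℝ (deriv c t) (deriv c t)
    set A := inner ℝ n (deriv (deriv c) t)
    set a := -(A / v) with ha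
    have hx : a • c t - (a • c t - n) = n := by abel
    have hd : a * (-a * ‖c t‖ ^ 2 + 2 * inner ℝ (a • c t - n) (c t)) < ‖a • c t - n‖ ^ 2 := by
      rw [norm_sub_sq_real, norm_smul, inner_sub_left, inner_smul_left, inner_smul_left, mul_pow,
        Real.norm_eq_abs, sq_abs, hn, real_inner_self_eq_norm_sq, real_inner_comm n]
      simp; nlinarith
    let σ : GenSphere := ⟨a, a • c t - n, -a * ‖c t‖ ^ 2 + 2 * inner ℝ (a • c t - n) (c t), hd⟩
    have he : σ.eqn (c t) = 0 := by simp only [GenSphere.eqn, σ]; ring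
    refine ⟨σ, (σ.osculates_iff hc).2 ⟨he, ?_, ?_, ?_⟩, he, 1, by simp [σ]⟩
    · change inner ℝ (a • c t - (a • c t - n)) _ = _
      rw [hx, hcn]
    · change a * v + inner ℝ (a • c t - (a • c t - n)) _ = _
      rw [hx, ha]; field_simp; ring
    · change 3 * a * _ + inner ℝ (a • c t - (a • c t - n)) _ = _
      rw [hx, ha]; field_simp; linarith

/-- The Darboux condition for a curve on a surface in terms of its components `u`, `w` with respect
to a principal frame along it. -/
theorem darboux_condition_frame {c N E₁ E₂ : ℝ → E3} {u w k₁ k₂ : ℝ → ℝ} {t u' w' k₁' k₂' : ℝ}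
    {E₁' E₂' : E3} (hc : ContDiffAt ℝ 3 c t)
    (hc' : ∀ᶠ s in 𝓝 t, deriv c s = u s • E₁ s + w s • E₂ s)
    (hN : ∀ᶠ s in 𝓝 t, HasDerivAt N (-((k₁ s * u s) • E₁ s + (k₂ s * w s) • E₂ s)) s)
    (h11 : ∀ᶠ s in 𝓝 t, inner ℝ (E₁ s) (E₁ s) = (1 : ℝ))
    (h22 : ∀ᶠ s in 𝓝 t, inner ℝ (E₂ s) (E₂ s) = (1 : ℝ))
    (h12 : ∀ᶠ s in 𝓝 t, inner ℝ (E₁ s) (E₂ s) = (0 : ℝ))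
    (hN1 : ∀ᶠ s in 𝓝 t, inner ℝ (N s) (E₁ s) = (0 : ℝ))
    (hN2 : ∀ᶠ s in 𝓝 t, inner ℝ (N s) (E₂ s) = (0 : ℝ))
    (hu : HasDerivAt u u' t) (hw : HasDerivAt w w' t) (hk₁ : HasDerivAt k₁ k₁' t)
    (hk₂ : HasDerivAt k₂ k₂' t) (hE₁ : HasDerivAt E₁ E₁' t) (hE₂ : HasDerivAt E₂ E₂' t) :
    3 * inner ℝ (N t) (deriv (deriv c) t) * inner ℝ (deriv c t) (deriv (deriv c) t) =
        inner ℝ (deriv c t) (deriv c t) * inner ℝ (N t) (deriv (deriv (deriv c)) t) ↔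
      (u t ^ 2 + w t ^ 2) * (k₁' * u t ^ 2 + k₂' * w t ^ 2
        - (k₁ t - k₂ t) * u t * w t * inner ℝ E₁' (E₂ t)) =
      3 * (k₁ t - k₂ t) * u t * w t * (u t * w' - w t * u') := by
  obtain ⟨h1, hc1⟩ := ContDiffAt.eventually_hasDerivAt (n := 2) (by norm_num; exact hc)
  obtain ⟨h2, hc2⟩ := ContDiffAt.eventually_hasDerivAt (n := 1) (by exact_mod_cast hc1)
  obtain ⟨h3, -⟩ := ContDiffAt.eventually_hasDerivAt (n := 0) (by simpa using hc2)
  have hA : (fun s => inner ℝ (N s) (deriv (deriv c) s)) =ᶠ[𝓝 t]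
      fun s => k₁ s * u s ^ 2 + k₂ s * w s ^ 2 := by
    have hz : (fun s => inner ℝ (N s) (deriv c s)) =ᶠ[𝓝 t] fun _ => (0 : ℝ) := by
      filter_upwards [hc', hN1, hN2] with s e e1 e2
      rw [e, inner_add_right, inner_smul_right, inner_smul_right, e1, e2]; simp
    filter_upwards [hz.eventuallyEq_nhds, hN, h2, hc', h11, h22, h12] with s e n d e' e11 e22 e12
    have := (n.inner ℝ d).deriv
    rw [e.deriv_eq, deriv_const, e'] at this
    have e21 : inner ℝ (E₂ s) (E₁ s) = (0 : ℝ) := by rw [real_inner_comm]; exact e12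
    simp only [inner_add_right, inner_add_left, inner_neg_left, inner_smul_left, inner_smul_right,
      e11, e12, e21, e22, conj_trivial] at this
    linarith
  have hcc : deriv (deriv c) t = u' • E₁ t + u t • E₁' + (w' • E₂ t + w t • E₂') := by
    have : deriv c =ᶠ[𝓝 t] fun s => u s • E₁ s + w s • E₂ s := hc'
    rw [this.deriv_eq]
    refine ((hu.smul hE₁).add (hw.smul hE₂)).deriv.trans ?_
    abel
  have hA' : inner ℝ (N t) (deriv (deriv (deriv c)) t) +
      inner ℝ (-((k₁ t * u t) • E₁ t + (k₂ t * w t) • E₂ t)) (deriv (deriv c) t) =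
      k₁' * u t ^ 2 + k₁ t * (2 * u t * u') + (k₂' * w t ^ 2 + k₂ t * (2 * w t * w')) := by
    have h4 := ((hk₁.mul (hu.pow 2)).add (hk₂.mul (hw.pow 2))).deriv
    have h5 := (hN.self_of_nhds.inner ℝ h3.self_of_nhds).deriv
    have h6 := hA.deriv_eq
    rw [h5] at h6
    rw [h6]
    refine h4.trans ?_
    simp
  have const_deriv : ∀ {A B : ℝ → E3} {A' B' : E3} {r : ℝ}, HasDerivAt A A' t → HasDerivAt B B' t →
      (∀ᶠ s in 𝓝 t, inner ℝ (A s) (B s) = r) → inner ℝ (A t) B' + inner ℝ A' (B t) = 0 := by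
    intro A B A' B' r hA hB h
    have : (fun s => inner ℝ (A s) (B s)) =ᶠ[𝓝 t] fun _ => r := h
    rw [← (hA.inner ℝ hB).deriv, this.deriv_eq, deriv_const]
  have p1 := const_deriv hE₁ hE₁ h11
  have p2 := const_deriv hE₂ hE₂ h22
  have p3 := const_deriv hE₁ hE₂ h12
  have e0 := hA.self_of_nhds
  simp only at e0
  have e11 := h11.self_of_nhds
  have e22 := h22.self_of_nhds
  have e12 := h12.self_of_nhds
  have e21 : inner ℝ (E₂ t) (E₁ t) = (0 : ℝ) := by rw [real_inner_comm]; exact e12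
  rw [e0]
  rw [hcc] at hA' ⊢
  rw [hc'.self_of_nhds]
  simp only [inner_add_right, inner_add_left, inner_neg_left, inner_smul_left, inner_smul_right,
      e11, e12, e21, e22, conj_trivial] at hA' ⊢
  simp only [real_inner_comm (E₁ t), real_inner_comm (E₂ t)] at p1 p2 p3 hA' ⊢
  generalize inner ℝ (N t) (deriv (deriv (deriv c)) t) = T at *
  have p1' : inner ℝ (E₁ t) E₁' = (0 : ℝ) := by linarith
  have p2' : inner ℝ (E₂ t) E₂' = (0 : ℝ) := by linarith
  have p3' : inner ℝ (E₁ t) E₂' = -inner ℝ (E₂ t) E₁' := by linarith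
  rw [p1', p2', p3'] at hA' ⊢
  generalize inner ℝ (E₂ t) E₁' = O at *
  have hT := eq_sub_of_add_eq hA'
  rw [hT]
  constructor <;> intro h <;> linear_combination -h

namespace IsPrincipalPatch

variable {U : Set (EuclideanSpace ℝ (Fin 2))} {r N : EuclideanSpace ℝ (Fin 2) → E3}
    {a₁ a₂ : EuclideanSpace ℝ (Fin 2) → EuclideanSpace ℝ (Fin 2)}
    {k₁ k₂ : EuclideanSpace ℝ (Fin 2) → ℝ} {q : ℝ → EuclideanSpace ℝ (Fin 2)} {u w : ℝ → ℝ} {t : ℝ}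

theorem inner_frame (h : IsPrincipalPatch U r N a₁ a₂ k₁ k₂) {x : EuclideanSpace ℝ (Fin 2)}
    (hx : x ∈ U) :
    inner ℝ (fderiv ℝ r x (a₁ x)) (fderiv ℝ r x (a₁ x)) = (1 : ℝ) ∧
    inner ℝ (fderiv ℝ r x (a₂ x)) (fderiv ℝ r x (a₂ x)) = (1 : ℝ) ∧
    inner ℝ (fderiv ℝ r x (a₁ x)) (fderiv ℝ r x (a₂ x)) = (0 : ℝ) ∧
    inner ℝ (fderiv ℝ r x (a₂ x)) (fderiv ℝ r x (a₁ x)) = (0 : ℝ) := by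
  refine ⟨?_, ?_, h.orthogonal hx, by rw [real_inner_comm]; exact h.orthogonal hx⟩
  · rw [real_inner_self_eq_norm_sq, h.unit₁ x hx]; norm_num
  · rw [real_inner_self_eq_norm_sq, h.unit₂ x hx]; norm_num

theorem contDiffOn_frame (h : IsPrincipalPatch U r N a₁ a₂ k₁ k₂)
    {a : EuclideanSpace ℝ (Fin 2) → EuclideanSpace ℝ (Fin 2)} (ha : ContDiffOn ℝ ∞ a U) :
    ContDiffOn ℝ ∞ (fun y => fderiv ℝ r y (a y)) U :=
  ((contDiffOn_infty_iff_fderiv_of_isOpen h.isOpen).1 h.smooth_r).2.clm_apply ha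

/-- A vector orthogonal to the tangent plane is a multiple of the normal. -/
theorem orthogonal_tangent_iff (h : IsPrincipalPatch U r N a₁ a₂ k₁ k₂)
    {x : EuclideanSpace ℝ (Fin 2)} (hx : x ∈ U) (z : E3) :
    (∀ v, inner ℝ z (fderiv ℝ r x v) = 0) ↔ ∃ l : ℝ, z = l • N x := by
  constructor
  · intro hz
    refine ⟨inner ℝ (N x) z, ?_⟩
    conv_lhs => rw [h.expansion hx z, real_inner_comm z, hz, real_inner_comm z, hz]
    simp
  · rintro ⟨l, rfl⟩ v
    rw [inner_smul_left, h.normal x hx, mul_zero]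

theorem hasDerivAt_comp (h : IsPrincipalPatch U r N a₁ a₂ k₁ k₂) {W : Type*}
    [NormedAddCommGroup W] [NormedSpace ℝ W] {f : EuclideanSpace ℝ (Fin 2) → W} {v w' : ℝ}
    (hf : ContDiffOn ℝ ∞ f U) (hx : q t ∈ U)
    (hq : HasDerivAt q (v • a₁ (q t) + w' • a₂ (q t)) t) :
    HasDerivAt (fun s => f (q s))
      (v • fderiv ℝ f (q t) (a₁ (q t)) + w' • fderiv ℝ f (q t) (a₂ (q t))) t := by
  have := ((hf.contDiffAt (h.isOpen.mem_nhds hx)).differentiableAt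
    (by simp)).hasFDerivAt.comp_hasDerivAt t hq
  rw [map_add, map_smul, map_smul] at this
  exact this

/-- The equation of Darboux lines in terms of the components `u`, `w` of the velocity with respect
to the principal frame. -/
theorem darboux_iff (h : IsPrincipalPatch U r N a₁ a₂ k₁ k₂) {u' w' : ℝ}
    (hqs : ContDiffAt ℝ ∞ q t) (hx : q t ∈ U)
    (hq : ∀ᶠ s in 𝓝 t, HasDerivAt q (u s • a₁ (q s) + w s • a₂ (q s)) s)
    (hu : HasDerivAt u u' t) (hw : HasDerivAt w w' t) (h0 : u t ^ 2 + w t ^ 2 ≠ 0) :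
    (∃ σ : GenSphere, σ.Osculates (r ∘ q) t ∧ σ.eqn (r (q t)) = 0 ∧
      ∀ v, inner ℝ (σ.a • r (q t) - σ.b) (fderiv ℝ r (q t) v) = 0) ↔
    3 * (k₁ (q t) - k₂ (q t)) * u t * w t * (u t * w' - w t * u') =
      (u t ^ 2 + w t ^ 2) * (fderiv ℝ k₁ (q t) (a₁ (q t)) * u t ^ 3 +
        fderiv ℝ k₂ (q t) (a₂ (q t)) * w t ^ 3) := by
  have hxs : ∀ᶠ s in 𝓝 t, q s ∈ U := hqs.continuousAt.eventually (h.isOpen.mem_nhds hx)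
  have hqt := hq.self_of_nhds
  have hc : ContDiffAt ℝ 3 (r ∘ q) t :=
    ((h.smooth_r.contDiffAt (h.isOpen.mem_nhds hx)).comp t hqs).of_le
      (WithTop.coe_le_coe.2 le_top)
  have hc' : ∀ᶠ s in 𝓝 t, deriv (r ∘ q) s = u s • fderiv ℝ r (q s) (a₁ (q s)) +
      w s • fderiv ℝ r (q s) (a₂ (q s)) := by
    filter_upwards [hq, hxs] with s hs hxs
    exact (h.hasDerivAt_comp h.smooth_r hxs hs).deriv
  obtain ⟨e11, e22, e12, e21⟩ := h.inner_frame hx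
  have hne : deriv (r ∘ q) t ≠ 0 := by
    intro hz
    rw [hc'.self_of_nhds] at hz
    have h1 := congrArg (fun z => inner ℝ (fderiv ℝ r (q t) (a₁ (q t))) z) hz
    have h2 := congrArg (fun z => inner ℝ (fderiv ℝ r (q t) (a₂ (q t))) z) hz
    simp only [inner_add_right, inner_smul_right, e11, e12, e21, e22, inner_zero_right] at h1 h2
    apply h0
    nlinarith
  simp only [h.orthogonal_tangent_iff hx]
  refine (exists_osculating_sphere_iff hc hne (h.norm_N _ hx) ?_).trans ?_
  · rw [hc'.self_of_nhds, ← map_smul, ← map_smul, ← map_add]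
    exact h.normal _ hx _
  have hN : ∀ᶠ s in 𝓝 t, HasDerivAt (fun s => N (q s))
      (-((k₁ (q s) * u s) • fderiv ℝ r (q s) (a₁ (q s)) +
        (k₂ (q s) * w s) • fderiv ℝ r (q s) (a₂ (q s)))) s := by
    filter_upwards [hq, hxs] with s hs hxs
    convert! h.hasDerivAt_comp h.smooth_N hxs hs using 1
    rw [h.eigen₁ _ hxs, h.eigen₂ _ hxs, mul_comm (k₁ _), mul_comm (k₂ _), mul_smul, mul_smul,
      smul_neg, smul_neg, neg_add]
  refine (darboux_condition_frame hc hc' hN (hxs.mono fun s hs => (h.inner_frame hs).1)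
    (hxs.mono fun s hs => (h.inner_frame hs).2.1) (hxs.mono fun s hs => (h.inner_frame hs).2.2.1)
    (hxs.mono fun s hs => h.normal _ hs _) (hxs.mono fun s hs => h.normal _ hs _)
    hu hw (h.hasDerivAt_comp h.smooth_k₁ hx hqt) (h.hasDerivAt_comp h.smooth_k₂ hx hqt)
    (h.hasDerivAt_comp (h.contDiffOn_frame h.smooth_a₁) hx hqt)
    (h.hasDerivAt_comp (h.contDiffOn_frame h.smooth_a₂) hx hqt)).trans ?_
  obtain ⟨c1, c2⟩ := h.codazzi hx
  rw [inner_add_left, inner_smul_left, inner_smul_left, c1, c2]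
  simp only [smul_eq_mul, conj_trivial]
  constructor <;> intro h' <;> linear_combination -h'

end IsPrincipalPatch

/-- A tangent field along an immersed patch is smooth if it is smooth as a field in space. -/
theorem contDiffOn_of_contDiffOn_push {U : Set (EuclideanSpace ℝ (Fin 2))}
    {r N Z : EuclideanSpace ℝ (Fin 2) → E3}
    {a : EuclideanSpace ℝ (Fin 2) → EuclideanSpace ℝ (Fin 2)} (hU : IsOpen U)
    (hr : ContDiffOn ℝ ∞ r U) (hN : ContDiffOn ℝ ∞ N U) (hZ : ContDiffOn ℝ ∞ Z U)
    (hi : ∀ x ∈ U, Function.Injective (fderiv ℝ r x)) (hN1 : ∀ x ∈ U, ‖N x‖ = 1)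
    (hn : ∀ x ∈ U, ∀ v, inner ℝ (N x) (fderiv ℝ r x v) = 0)
    (ha : ∀ x ∈ U, fderiv ℝ r x (a x) = Z x) : ContDiffOn ℝ ∞ a U := by
  let L : EuclideanSpace ℝ (Fin 2) → EuclideanSpace ℝ (Fin 2) × ℝ →L[ℝ] E3 := fun x =>
    (fderiv ℝ r x).comp (ContinuousLinearMap.fst ℝ _ _) +
      (ContinuousLinearMap.snd ℝ (EuclideanSpace ℝ (Fin 2)) ℝ).smulRight (N x)
  have hL : ContDiffOn ℝ ∞ L U :=
    (((contDiffOn_infty_iff_fderiv_of_isOpen hU).1 hr).2.clm_comp contDiffOn_const).add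
      (contDiffOn_const.smulRight hN)
  have hinj : ∀ x ∈ U, Function.Injective (L x) := by
    intro x hx
    rw [injective_iff_map_eq_zero]
    rintro ⟨v, s⟩ h
    have h' : fderiv ℝ r x v + s • N x = 0 := h
    have h1 := congrArg (fun z => inner ℝ (N x) z) h'
    simp only [inner_add_right, hn x hx, inner_smul_right, real_inner_self_eq_norm_sq, hN1 x hx,
      inner_zero_right] at h1
    have hs : s = 0 := by linarith
    rw [hs, zero_smul, add_zero] at h'
    have hv : v = 0 := hi x hx (by rw [h', map_zero])
    rw [hs, hv]; rfl
  have hinv : ∀ x ∈ U, ∃ A : (EuclideanSpace ℝ (Fin 2) × ℝ) ≃L[ℝ] E3,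
      (A : EuclideanSpace ℝ (Fin 2) × ℝ →L[ℝ] E3) = L x := by
    intro x hx
    let A := (LinearEquiv.ofInjectiveOfFinrankEq
      (L x : EuclideanSpace ℝ (Fin 2) × ℝ →ₗ[ℝ] E3) (hinj x hx) (by simp)).toContinuousLinearEquiv
    exact ⟨A, ContinuousLinearMap.ext fun _ => rfl⟩
  have hax : ∀ x ∈ U, a x = ((L x).inverse (Z x)).1 := by
    intro x hx
    obtain ⟨A, hA⟩ := hinv x hx
    have : Z x = L x (a x, 0) := by simp [L, ha x hx]
    rw [this, ← hA, ContinuousLinearMap.inverse_equiv]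
    simp
  refine ContDiffOn.congr (fun x hx => ?_) hax
  obtain ⟨A, hA⟩ := hinv x hx
  have h1 : ContDiffAt ℝ ∞ ContinuousLinearMap.inverse (L x) := hA ▸ contDiffAt_map_inverse A
  have h2 := (h1.comp_contDiffWithinAt x (hL x hx)).clm_apply (hZ x hx)
  exact contDiff_fst.contDiffAt.comp_contDiffWithinAt x h2

section Chart

variable {M : Type*} [TopologicalSpace M] [ChartedSpace (EuclideanSpace ℝ (Fin 2)) M]
  [IsManifold (𝓡 2) ∞ M] {W : Type*} [NormedAddCommGroup W] [NormedSpace ℝ W]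

/-- The coordinate expression of a tangent vector at the point with coordinates `x`. -/
noncomputable def chartVec (p : M) (x : EuclideanSpace ℝ (Fin 2))
    (v : TangentSpace (𝓡 2) ((extChartAt (𝓡 2) p).symm x)) : EuclideanSpace ℝ (Fin 2) :=
  mfderiv (𝓡 2) 𝓘(ℝ, EuclideanSpace ℝ (Fin 2)) (extChartAt (𝓡 2) p)
    ((extChartAt (𝓡 2) p).symm x) v

theorem mdifferentiableAt_chart {p : M} {x : EuclideanSpace ℝ (Fin 2)}
    (hx : x ∈ (extChartAt (𝓡 2) p).target) :
    MDifferentiableAt (𝓡 2) 𝓘(ℝ, EuclideanSpace ℝ (Fin 2)) (extChartAt (𝓡 2) p)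
      ((extChartAt (𝓡 2) p).symm x) :=
  mdifferentiableAt_extChartAt (by
    rw [← extChartAt_source (𝓡 2)]; exact (extChartAt (𝓡 2) p).map_target hx)

theorem chartVec_surjective {p : M} {x : EuclideanSpace ℝ (Fin 2)}
    (hx : x ∈ (extChartAt (𝓡 2) p).target) (v : EuclideanSpace ℝ (Fin 2)) :
    ∃ v', chartVec p x v' = v := by
  obtain ⟨A, hA⟩ := isInvertible_mfderiv_extChartAt (I := 𝓡 2)
    ((extChartAt (𝓡 2) p).map_target hx)
  refine ⟨A.symm v, ?_⟩
  unfold chartVec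
  rw [← hA]
  exact A.apply_symm_apply v

theorem differentiableAt_comp_chart_symm {p : M} {f : M → W} {x : EuclideanSpace ℝ (Fin 2)}
    (hx : x ∈ (extChartAt (𝓡 2) p).target)
    (hf : MDifferentiableAt (𝓡 2) 𝓘(ℝ, W) f ((extChartAt (𝓡 2) p).symm x)) :
    DifferentiableAt ℝ (f ∘ (extChartAt (𝓡 2) p).symm) x := by
  have h1 : MDifferentiableAt 𝓘(ℝ, EuclideanSpace ℝ (Fin 2)) (𝓡 2) (extChartAt (𝓡 2) p).symm x :=
    ((contMDiffOn_extChartAt_symm (n := ∞) p).contMDiffAt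
      ((isOpen_extChartAt_target p).mem_nhds hx)).mdifferentiableAt (by simp)
  exact (hf.comp x h1).differentiableAt

theorem fderiv_comp_chart_symm {p : M} {f : M → W} {x : EuclideanSpace ℝ (Fin 2)}
    (hx : x ∈ (extChartAt (𝓡 2) p).target)
    (hf : MDifferentiableAt (𝓡 2) 𝓘(ℝ, W) f ((extChartAt (𝓡 2) p).symm x))
    (v : TangentSpace (𝓡 2) ((extChartAt (𝓡 2) p).symm x)) :
    fderiv ℝ (f ∘ (extChartAt (𝓡 2) p).symm) x (chartVec p x v) =
      mfderiv (𝓡 2) 𝓘(ℝ, W) f ((extChartAt (𝓡 2) p).symm x) v := by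
  set e := extChartAt (𝓡 2) p with he
  have hd := differentiableAt_comp_chart_symm hx hf
  have hex : e (e.symm x) = x := e.right_inv hx
  have heq : f =ᶠ[𝓝 (e.symm x)] (f ∘ e.symm) ∘ e := by
    filter_upwards [extChartAt_source_mem_nhds' (I := 𝓡 2) (e.map_target hx)] with y hy
    simp [e.left_inv hy]
  have h1 : HasMFDerivAt 𝓘(ℝ, EuclideanSpace ℝ (Fin 2)) 𝓘(ℝ, W) (f ∘ e.symm) (e (e.symm x))
      (fderiv ℝ (f ∘ e.symm) x) := by
    rw [hex]; exact hd.hasFDerivAt.hasMFDerivAt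
  have h2 := (h1.comp (e.symm x) (mdifferentiableAt_chart hx).hasMFDerivAt).congr_of_eventuallyEq
    heq
  rw [h2.mfderiv]
  rfl

theorem ContMDiff.contDiffOn_comp_chart_symm {f : M → W} (hf : ContMDiff (𝓡 2) 𝓘(ℝ, W) ∞ f)
    (p : M) : ContDiffOn ℝ ∞ (f ∘ (extChartAt (𝓡 2) p).symm) (extChartAt (𝓡 2) p).target :=
  (hf.comp_contMDiffOn (contMDiffOn_extChartAt_symm p)).contDiffOn

end Chart

namespace OrientedSurface.PrincipalFrame

variable {M : Type*} [TopologicalSpace M] [ChartedSpace (EuclideanSpace ℝ (Fin 2)) M]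
  [IsManifold (𝓡 2) ∞ M] {S : OrientedSurface M}

theorem push_chartVec (S : OrientedSurface M) {p : M} {x : EuclideanSpace ℝ (Fin 2)}
    (hx : x ∈ (extChartAt (𝓡 2) p).target)
    (v : TangentSpace (𝓡 2) ((extChartAt (𝓡 2) p).symm x)) :
    fderiv ℝ (S.ι ∘ (extChartAt (𝓡 2) p).symm) x (chartVec p x v) =
      S.push ((extChartAt (𝓡 2) p).symm x) v :=
  fderiv_comp_chart_symm hx (S.smooth_ι.mdifferentiable (by simp) _) v

theorem dN_chartVec (S : OrientedSurface M) {p : M} {x : EuclideanSpace ℝ (Fin 2)}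
    (hx : x ∈ (extChartAt (𝓡 2) p).target)
    (v : TangentSpace (𝓡 2) ((extChartAt (𝓡 2) p).symm x)) :
    fderiv ℝ (S.N ∘ (extChartAt (𝓡 2) p).symm) x (chartVec p x v) =
      S.dN ((extChartAt (𝓡 2) p).symm x) v :=
  fderiv_comp_chart_symm hx (S.smooth_N.mdifferentiable (by simp) _) v

/-- In a chart, an umbilic free surface with principal frame becomes a principal patch. -/
theorem isPrincipalPatch (F : S.PrincipalFrame) (p : M) :
    IsPrincipalPatch (extChartAt (𝓡 2) p).target (S.ι ∘ (extChartAt (𝓡 2) p).symm)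
      (S.N ∘ (extChartAt (𝓡 2) p).symm)
      (fun x => chartVec p x (F.X₁ ((extChartAt (𝓡 2) p).symm x)))
      (fun x => chartVec p x (F.X₂ ((extChartAt (𝓡 2) p).symm x)))
      (F.k₁ ∘ (extChartAt (𝓡 2) p).symm) (F.k₂ ∘ (extChartAt (𝓡 2) p).symm) := by
  set e := extChartAt (𝓡 2) p with he
  have hU : IsOpen e.target := isOpen_extChartAt_target p
  have hr := S.smooth_ι.contDiffOn_comp_chart_symm p
  have hN := S.smooth_N.contDiffOn_comp_chart_symm p
  have hi : ∀ x ∈ e.target, Function.Injective (fderiv ℝ (S.ι ∘ e.symm) x) := by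
    intro x hx
    rw [injective_iff_map_eq_zero]
    intro v hv
    obtain ⟨v', rfl⟩ := chartVec_surjective hx v
    rw [push_chartVec S hx] at hv
    have : v' = 0 := S.immersion (e.symm x) (by rw [map_zero]; exact hv)
    rw [this]; exact map_zero _
  have hn : ∀ x ∈ e.target, ∀ v, inner ℝ ((S.N ∘ e.symm) x) (fderiv ℝ (S.ι ∘ e.symm) x v) = 0 := by
    intro x hx v
    obtain ⟨v', rfl⟩ := chartVec_surjective hx v
    rw [push_chartVec S hx]
    exact S.normal _ v'
  have ha₁ := contDiffOn_of_contDiffOn_push hU hr hN (F.smooth_X₁.contDiffOn_comp_chart_symm p) hi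
    (fun x _ => S.norm_N _) hn (fun x hx => push_chartVec S hx (F.X₁ (e.symm x)))
  have ha₂ := contDiffOn_of_contDiffOn_push hU hr hN (F.smooth_X₂.contDiffOn_comp_chart_symm p) hi
    (fun x _ => S.norm_N _) hn (fun x hx => push_chartVec S hx (F.X₂ (e.symm x)))
  have hdr := ((contDiffOn_infty_iff_fderiv_of_isOpen hU).1 hr).2
  have hdN := ((contDiffOn_infty_iff_fderiv_of_isOpen hU).1 hN).2
  refine ⟨hU, hr, hN, ha₁, ha₂, ?_, ?_, hi, fun x _ => S.norm_N _, hn, ?_, ?_, ?_, ?_,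
    fun x _ => F.umbilic_free _⟩
  · refine ((hdN.clm_apply ha₁).inner ℝ (hdr.clm_apply ha₁)).neg.congr fun x hx => ?_
    rw [push_chartVec S hx, dN_chartVec S hx, F.eigen₁, inner_neg_left, inner_smul_left,
      real_inner_self_eq_norm_sq, F.unit_X₁]
    simp [he]
  · refine ((hdN.clm_apply ha₂).inner ℝ (hdr.clm_apply ha₂)).neg.congr fun x hx => ?_
    rw [push_chartVec S hx, dN_chartVec S hx, F.eigen₂, inner_neg_left, inner_smul_left,
      real_inner_self_eq_norm_sq, F.unit_X₂]
    simp [he]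
  · intro x hx; rw [push_chartVec S hx]; exact F.unit_X₁ _
  · intro x hx; rw [push_chartVec S hx]; exact F.unit_X₂ _
  · intro x hx; rw [push_chartVec S hx, dN_chartVec S hx]; exact F.eigen₁ _
  · intro x hx; rw [push_chartVec S hx, dN_chartVec S hx]; exact F.eigen₂ _

end OrientedSurface.PrincipalFrame

section ChartCalculus

variable {M : Type*} [TopologicalSpace M] [ChartedSpace (EuclideanSpace ℝ (Fin 2)) M]
  [IsManifold (𝓡 2) ∞ M] {W : Type*} [NormedAddCommGroup W] [NormedSpace ℝ W]

theorem mdifferentiableAt_of_comp_chart_symm {p : M} {f : M → W} {x : EuclideanSpace ℝ (Fin 2)}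
    (hx : x ∈ (extChartAt (𝓡 2) p).target)
    (hf : DifferentiableAt ℝ (f ∘ (extChartAt (𝓡 2) p).symm) x) :
    MDifferentiableAt (𝓡 2) 𝓘(ℝ, W) f ((extChartAt (𝓡 2) p).symm x) := by
  set e := extChartAt (𝓡 2) p with he
  have hex : e (e.symm x) = x := e.right_inv hx
  have heq : f =ᶠ[𝓝 (e.symm x)] (f ∘ e.symm) ∘ e := by
    filter_upwards [extChartAt_source_mem_nhds' (I := 𝓡 2) (e.map_target hx)] with y hy
    simp [e.left_inv hy]
  have h1 : MDifferentiableAt 𝓘(ℝ, EuclideanSpace ℝ (Fin 2)) 𝓘(ℝ, W) (f ∘ e.symm)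
      (e (e.symm x)) := by
    rw [hex]; exact hf.mdifferentiableAt
  exact (h1.comp (e.symm x) (mdifferentiableAt_chart hx)).congr_of_eventuallyEq heq

theorem mdifferentiable_of_contDiffOn_chart {f : M → W}
    (hf : ∀ p : M, ContDiffOn ℝ ∞ (f ∘ (extChartAt (𝓡 2) p).symm) (extChartAt (𝓡 2) p).target) :
    MDifferentiable (𝓡 2) 𝓘(ℝ, W) f := by
  intro p
  have hx := mem_extChartAt_target (I := 𝓡 2) p
  have := mdifferentiableAt_of_comp_chart_symm hx (((hf p).contDiffAt
    ((isOpen_extChartAt_target p).mem_nhds hx)).differentiableAt (by simp))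
  rwa [extChartAt_to_inv] at this

end ChartCalculus

namespace OrientedSurface.PrincipalFrame

variable {M : Type*} [TopologicalSpace M] [ChartedSpace (EuclideanSpace ℝ (Fin 2)) M]
  {S : OrientedSurface M}

theorem μ_pos (F : S.PrincipalFrame) (p : M) : 0 < F.μ p := by
  have := F.umbilic_free p
  unfold μ; linarith

theorem dirDeriv_k₁ (F : S.PrincipalFrame) (p : M) :
    dirDeriv F.X₁ F.k₁ p = F.μ p ^ 2 * F.θ₁ p := by
  have := (F.μ_pos p).ne'
  unfold θ₁; field_simp

theorem dirDeriv_k₂ (F : S.PrincipalFrame) (p : M) :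
    dirDeriv F.X₂ F.k₂ p = F.μ p ^ 2 * F.θ₂ p := by
  have := (F.μ_pos p).ne'
  unfold θ₂; field_simp

end OrientedSurface.PrincipalFrame

namespace OrientedSurface.PrincipalFrame

variable {M : Type*} [TopologicalSpace M] [ChartedSpace (EuclideanSpace ℝ (Fin 2)) M]
  [IsManifold (𝓡 2) ∞ M] {S : OrientedSurface M}

theorem inner_frame (F : S.PrincipalFrame) (p : M) :
    inner ℝ (S.push p (F.X₁ p)) (S.push p (F.X₁ p)) = (1 : ℝ) ∧
    inner ℝ (S.push p (F.X₂ p)) (S.push p (F.X₂ p)) = (1 : ℝ) ∧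
    inner ℝ (S.push p (F.X₁ p)) (S.push p (F.X₂ p)) = (0 : ℝ) ∧
    inner ℝ (S.push p (F.X₂ p)) (S.push p (F.X₁ p)) = (0 : ℝ) := by
  have hx := mem_extChartAt_target (I := 𝓡 2) p
  have := (F.isPrincipalPatch p).inner_frame hx
  simp only [push_chartVec S hx] at this
  rwa [extChartAt_to_inv] at this

theorem push_eq (F : S.PrincipalFrame) (p : M) (v : TangentSpace (𝓡 2) p) :
    S.push p v = inner ℝ (S.push p (F.X₁ p)) (S.push p v) • S.push p (F.X₁ p) +
      inner ℝ (S.push p (F.X₂ p)) (S.push p v) • S.push p (F.X₂ p) := by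
  have key : ∀ x ∈ (extChartAt (𝓡 2) p).target, (fun m : M => ∀ v : TangentSpace (𝓡 2) m,
      S.push m v = inner ℝ (S.push m (F.X₁ m)) (S.push m v) • S.push m (F.X₁ m) +
      inner ℝ (S.push m (F.X₂ m)) (S.push m v) • S.push m (F.X₂ m))
      ((extChartAt (𝓡 2) p).symm x) := by
    intro x hx v
    have := congrArg (fderiv ℝ (S.ι ∘ (extChartAt (𝓡 2) p).symm) x)
      ((F.isPrincipalPatch p).expansion_tangent hx (chartVec p x v))
    simpa only [map_add, map_smul, push_chartVec S hx] using this
  have h := key _ (mem_extChartAt_target (I := 𝓡 2) p)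
  rw [extChartAt_to_inv] at h
  exact h v

theorem mdifferentiable_k₁ (F : S.PrincipalFrame) : MDifferentiable (𝓡 2) 𝓘(ℝ, ℝ) F.k₁ :=
  mdifferentiable_of_contDiffOn_chart fun p => (F.isPrincipalPatch p).smooth_k₁

theorem mdifferentiable_k₂ (F : S.PrincipalFrame) : MDifferentiable (𝓡 2) 𝓘(ℝ, ℝ) F.k₂ :=
  mdifferentiable_of_contDiffOn_chart fun p => (F.isPrincipalPatch p).smooth_k₂

theorem fderiv_k₁_chart (F : S.PrincipalFrame) {p : M} {x : EuclideanSpace ℝ (Fin 2)}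
    (hx : x ∈ (extChartAt (𝓡 2) p).target) :
    fderiv ℝ (F.k₁ ∘ (extChartAt (𝓡 2) p).symm) x
      (chartVec p x (F.X₁ ((extChartAt (𝓡 2) p).symm x))) =
    dirDeriv F.X₁ F.k₁ ((extChartAt (𝓡 2) p).symm x) :=
  fderiv_comp_chart_symm hx (F.mdifferentiable_k₁ _) _

theorem fderiv_k₂_chart (F : S.PrincipalFrame) {p : M} {x : EuclideanSpace ℝ (Fin 2)}
    (hx : x ∈ (extChartAt (𝓡 2) p).target) :
    fderiv ℝ (F.k₂ ∘ (extChartAt (𝓡 2) p).symm) x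
      (chartVec p x (F.X₂ ((extChartAt (𝓡 2) p).symm x))) =
    dirDeriv F.X₂ F.k₂ ((extChartAt (𝓡 2) p).symm x) :=
  fderiv_comp_chart_symm hx (F.mdifferentiable_k₂ _) _

theorem contDiffOn_μ_chart (F : S.PrincipalFrame) (p : M) :
    ContDiffOn ℝ ∞ (F.μ ∘ (extChartAt (𝓡 2) p).symm) (extChartAt (𝓡 2) p).target :=
  ((F.isPrincipalPatch p).smooth_k₁.sub (F.isPrincipalPatch p).smooth_k₂).div_const 2

theorem contDiffOn_dirDeriv_k₁ (F : S.PrincipalFrame) (p : M) :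
    ContDiffOn ℝ ∞ (dirDeriv F.X₁ F.k₁ ∘ (extChartAt (𝓡 2) p).symm)
      (extChartAt (𝓡 2) p).target := by
  have h := F.isPrincipalPatch p
  exact (((contDiffOn_infty_iff_fderiv_of_isOpen h.isOpen).1 h.smooth_k₁).2.clm_apply
    h.smooth_a₁).congr fun x hx => (F.fderiv_k₁_chart hx).symm

theorem contDiffOn_dirDeriv_k₂ (F : S.PrincipalFrame) (p : M) :
    ContDiffOn ℝ ∞ (dirDeriv F.X₂ F.k₂ ∘ (extChartAt (𝓡 2) p).symm)
      (extChartAt (𝓡 2) p).target := by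
  have h := F.isPrincipalPatch p
  exact (((contDiffOn_infty_iff_fderiv_of_isOpen h.isOpen).1 h.smooth_k₂).2.clm_apply
    h.smooth_a₂).congr fun x hx => (F.fderiv_k₂_chart hx).symm

theorem contDiffOn_θ₁_chart (F : S.PrincipalFrame) (p : M) :
    ContDiffOn ℝ ∞ (F.θ₁ ∘ (extChartAt (𝓡 2) p).symm) (extChartAt (𝓡 2) p).target :=
  (contDiffOn_const.div ((F.contDiffOn_μ_chart p).pow 2)
    fun _ _ => pow_ne_zero 2 (F.μ_pos _).ne').mul (F.contDiffOn_dirDeriv_k₁ p)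

theorem contDiffOn_θ₂_chart (F : S.PrincipalFrame) (p : M) :
    ContDiffOn ℝ ∞ (F.θ₂ ∘ (extChartAt (𝓡 2) p).symm) (extChartAt (𝓡 2) p).target :=
  (contDiffOn_const.div ((F.contDiffOn_μ_chart p).pow 2)
    fun _ _ => pow_ne_zero 2 (F.μ_pos _).ne').mul (F.contDiffOn_dirDeriv_k₂ p)

theorem mdifferentiable_μ (F : S.PrincipalFrame) : MDifferentiable (𝓡 2) 𝓘(ℝ, ℝ) F.μ :=
  mdifferentiable_of_contDiffOn_chart F.contDiffOn_μ_chart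

theorem mdifferentiable_θ₁ (F : S.PrincipalFrame) : MDifferentiable (𝓡 2) 𝓘(ℝ, ℝ) F.θ₁ :=
  mdifferentiable_of_contDiffOn_chart F.contDiffOn_θ₁_chart

theorem mdifferentiable_θ₂ (F : S.PrincipalFrame) : MDifferentiable (𝓡 2) 𝓘(ℝ, ℝ) F.θ₂ :=
  mdifferentiable_of_contDiffOn_chart F.contDiffOn_θ₂_chart

end OrientedSurface.PrincipalFrame

namespace OrientedSurface

variable {M : Type*} [TopologicalSpace M] [ChartedSpace (EuclideanSpace ℝ (Fin 2)) M]
  {W : Type*} [NormedAddCommGroup W] [NormedSpace ℝ W]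

theorem vel_eq_push (S : OrientedSurface M) {γ : ℝ → M} {t : ℝ}
    (hγ : MDifferentiableAt 𝓘(ℝ, ℝ) (𝓡 2) γ t) :
    S.vel γ t = S.push (γ t) (mfderiv 𝓘(ℝ, ℝ) (𝓡 2) γ t (1 : ℝ)) := by
  have h := (S.smooth_ι.mdifferentiable (by simp) (γ t)).hasMFDerivAt.comp t hγ.hasMFDerivAt
  let A : EuclideanSpace ℝ (Fin 2) →L[ℝ] E3 := mfderiv (𝓡 2) 𝓘(ℝ, E3) S.ι (γ t)
  let B : ℝ →L[ℝ] EuclideanSpace ℝ (Fin 2) := mfderiv 𝓘(ℝ, ℝ) (𝓡 2) γ t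
  have h' : HasFDerivAt (S.ι ∘ γ) (A.comp B) t := h.hasFDerivAt
  exact h'.hasDerivAt.deriv

/-- The derivative of a function along a curve with velocity `v`. -/
theorem hasDerivAt_comp_curve (S : OrientedSurface M) {γ : ℝ → M} {t : ℝ}
    (hγ : MDifferentiableAt 𝓘(ℝ, ℝ) (𝓡 2) γ t) {v : TangentSpace (𝓡 2) (γ t)}
    (hv : S.vel γ t = S.push (γ t) v) {f : M → W} (hf : MDifferentiableAt (𝓡 2) 𝓘(ℝ, W) f (γ t)) :
    HasDerivAt (fun s => f (γ s)) (mfderiv (𝓡 2) 𝓘(ℝ, W) f (γ t) v) t := by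
  have h := hf.hasMFDerivAt.comp t hγ.hasMFDerivAt
  have hv' : v = mfderiv 𝓘(ℝ, ℝ) (𝓡 2) γ t (1 : ℝ) :=
    S.immersion (γ t) (hv.symm.trans (S.vel_eq_push hγ))
  rw [hv']
  let A : EuclideanSpace ℝ (Fin 2) →L[ℝ] W := mfderiv (𝓡 2) 𝓘(ℝ, W) f (γ t)
  let B : ℝ →L[ℝ] EuclideanSpace ℝ (Fin 2) := mfderiv 𝓘(ℝ, ℝ) (𝓡 2) γ t
  have h' : HasFDerivAt (f ∘ γ) (A.comp B) t := h.hasFDerivAt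
  exact h'.hasDerivAt

theorem tangentSphere_chart_iff [IsManifold (𝓡 2) ∞ M] (S : OrientedSurface M) (σ : GenSphere)
    {p : M}
    {x : EuclideanSpace ℝ (Fin 2)} (hx : x ∈ (extChartAt (𝓡 2) p).target) :
    S.TangentSphere σ ((extChartAt (𝓡 2) p).symm x) ↔
      σ.eqn ((S.ι ∘ (extChartAt (𝓡 2) p).symm) x) = 0 ∧
      ∀ v, inner ℝ (σ.a • (S.ι ∘ (extChartAt (𝓡 2) p).symm) x - σ.b)
        (fderiv ℝ (S.ι ∘ (extChartAt (𝓡 2) p).symm) x v) = 0 := by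
  refine and_congr Iff.rfl ⟨fun h v => ?_, fun h v => ?_⟩
  · obtain ⟨v', rfl⟩ := chartVec_surjective hx v
    rw [PrincipalFrame.push_chartVec S hx]
    exact h v'
  · rw [← PrincipalFrame.push_chartVec S hx]
    exact h _

end OrientedSurface

theorem hasDerivAt_arccos_div_sqrt {u w : ℝ → ℝ} {t u' w' : ℝ} (hu : HasDerivAt u u' t)
    (hw : HasDerivAt w w' t) (h0 : w t ≠ 0) :
    HasDerivAt (fun s => Real.arccos (u s / √(u s ^ 2 + w s ^ 2)))
      ((u t * w' - w t * u') * (w t / |w t|) / (u t ^ 2 + w t ^ 2)) t := by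
  have hpos : 0 < u t ^ 2 + w t ^ 2 := by positivity
  set v := √(u t ^ 2 + w t ^ 2) with hv
  have hv0 : 0 < v := Real.sqrt_pos.2 hpos
  have hv2 : v ^ 2 = u t ^ 2 + w t ^ 2 := Real.sq_sqrt hpos.le
  have hw0 : 0 < |w t| := abs_pos.2 h0
  have hd : HasDerivAt (fun s => u s / √(u s ^ 2 + w s ^ 2))
      (-(w t * (u t * w' - w t * u') / v ^ 3)) t := by
    have h1 : HasDerivAt (fun s => u s ^ 2 + w s ^ 2) (2 * u t * u' + 2 * w t * w') t := by
      simpa using (hu.fun_pow 2).fun_add (hw.fun_pow 2)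
    refine (hu.div (h1.sqrt hpos.ne') hv0.ne').congr_deriv ?_
    rw [← hv]
    field_simp
    rw [hv2]
    ring
  have hx : 1 - (u t / v) ^ 2 = (|w t| / v) ^ 2 := by
    rw [div_pow, div_pow, sq_abs, hv2]; field_simp; ring
  have hlt : (u t / v) ^ 2 < 1 := by
    have : 0 < (|w t| / v) ^ 2 := by positivity
    linarith
  have hlt' := abs_lt.1 ((sq_lt_one_iff_abs_lt_one _).1 hlt)
  refine ((Real.hasDerivAt_arccos hlt'.1.ne' hlt'.2.ne).comp t hd).congr_deriv ?_
  rw [hx, Real.sqrt_sq (by positivity), ← hv2]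
  field_simp

/-- Critical points and extrema of the angle `arccos (u / √(u ^ 2 + w ^ 2))` when the vector
`(u, w)` turns at a rate proportional to a function `g`. -/
theorem arccos_div_sqrt_critical {f u w m g : ℝ → ℝ} {t : ℝ}
    (hf : ∀ᶠ s in 𝓝 t, f s = Real.arccos (u s / √(u s ^ 2 + w s ^ 2)))
    (hu : ∀ᶠ s in 𝓝 t, DifferentiableAt ℝ u s) (hw : ∀ᶠ s in 𝓝 t, DifferentiableAt ℝ w s)
    (hu0 : u t ≠ 0) (hw0 : w t ≠ 0) (hm0 : m t ≠ 0) (hm : DifferentiableAt ℝ m t)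
    (hg : ∀ᶠ s in 𝓝 t, 6 * u s * w s * (u s * deriv w s - w s * deriv u s) =
      m s * (u s ^ 2 + w s ^ 2) * g s) :
    (HasDerivAt f 0 t ↔ g t = 0) ∧
      ∀ g' : ℝ, g t = 0 → HasDerivAt g g' t → g' ≠ 0 → IsStrictLocalExtremum f t := by
  set h : ℝ → ℝ := fun s => m s / (6 * u s * w s) * (w s / |w s|) with hh
  have hut := hu.self_of_nhds
  have hwt := hw.self_of_nhds
  have hu0s := hut.continuousAt.eventually_ne hu0
  have hw0s := hwt.continuousAt.eventually_ne hw0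
  have hwa : |w t| ≠ 0 := abs_ne_zero.2 hw0
  have ht : h t ≠ 0 := mul_ne_zero (div_ne_zero hm0 (by positivity)) (div_ne_zero hw0 hwa)
  have hd : DifferentiableAt ℝ h t :=
    (hm.div ((hut.const_mul 6).mul hwt) (show 6 * u t * w t ≠ 0 by positivity)).mul
      (hwt.div (hwt.abs hw0) hwa)
  have key : ∀ᶠ s in 𝓝 t, HasDerivAt f (h s * g s) s := by
    filter_upwards [hf.eventually_nhds, hu, hw, hu0s, hw0s, hg] with s hfs hus hws hu0 hw0 hgs
    refine ((hasDerivAt_arccos_div_sqrt hus.hasDerivAt hws.hasDerivAt hw0).congr_of_eventuallyEq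
      hfs).congr_deriv ?_
    have hp : 0 < u s ^ 2 + w s ^ 2 := by positivity
    have hwa : |w s| ≠ 0 := abs_ne_zero.2 hw0
    have : u s * deriv w s - w s * deriv u s =
        m s * (u s ^ 2 + w s ^ 2) * g s / (6 * u s * w s) := by
      rw [eq_div_iff (by positivity), ← hgs]; ring
    rw [this, hh]
    field_simp
  constructor
  · constructor
    · intro h'
      have := key.self_of_nhds.unique h'
      exact (mul_eq_zero.1 this).resolve_left ht
    · intro h'
      have := key.self_of_nhds
      rwa [h', mul_zero] at this
  · intro g' hgt hg' hne
    refine isStrictLocalExtremum_of_hasDerivAt key (by rw [hgt, mul_zero])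
      (hd.hasDerivAt.mul hg') ?_
    rw [hgt, mul_zero, zero_add]
    exact mul_ne_zero ht hne

theorem cbrt_pow_three (x : ℝ) : cbrt x ^ 3 = x := by
  unfold cbrt
  have h : (|x| ^ (1 / 3 : ℝ)) ^ 3 = |x| := by
    rw [← Real.rpow_natCast, ← Real.rpow_mul (abs_nonneg x)]; norm_num
  rw [mul_pow, h]
  rcases lt_trichotomy x 0 with hx | rfl | hx
  · rw [Real.sign_of_neg hx, abs_of_neg hx]; ring
  · simp
  · rw [Real.sign_of_pos hx, abs_of_pos hx]; ring

theorem cbrt_ne_zero {x : ℝ} (hx : x ≠ 0) : cbrt x ≠ 0 := by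
  intro h
  have := cbrt_pow_three x
  rw [h] at this
  apply hx
  rw [← this]; norm_num

theorem contDiffAt_cbrt {x : ℝ} (hx : x ≠ 0) : ContDiffAt ℝ ∞ cbrt x := by
  rcases lt_or_gt_of_ne hx with h | h
  · have : cbrt =ᶠ[𝓝 x] fun y => -((-y) ^ (1 / 3 : ℝ)) := by
      filter_upwards [gt_mem_nhds h] with y hy
      rw [cbrt, Real.sign_of_neg hy, abs_of_neg hy]; ring
    exact ((contDiffAt_id.neg.rpow_const_of_ne (by simpa using hx)).neg).congr_of_eventuallyEq this
  · have : cbrt =ᶠ[𝓝 x] fun y => y ^ (1 / 3 : ℝ) := by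
      filter_upwards [lt_mem_nhds h] with y hy
      rw [cbrt, Real.sign_of_pos hy, abs_of_pos hy]; ring
    exact (contDiffAt_id.rpow_const_of_ne hx).congr_of_eventuallyEq this

theorem cbrt_direction_iff {x y u w : ℝ} (hxy : x ≠ 0 ∨ y ≠ 0) :
    x * u ^ 3 + y * w ^ 3 = 0 ↔ ∃ r : ℝ, u = r * cbrt y ∧ w = -(r * cbrt x) := by
  constructor
  · intro h
    have h3 : (cbrt x * u) ^ 3 = (-(cbrt y * w)) ^ 3 := by
      have h4 : (-(cbrt y * w)) ^ 3 = -(cbrt y ^ 3 * w ^ 3) := by ring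
      rw [h4, mul_pow, cbrt_pow_three, cbrt_pow_three]; linarith
    have h4 : cbrt x * u = -(cbrt y * w) := (Odd.strictMono_pow (by decide : Odd 3)).injective h3
    rcases hxy with hx | hy
    · have := cbrt_ne_zero hx
      refine ⟨-(w / cbrt x), ?_, by field_simp⟩
      field_simp; linarith
    · have := cbrt_ne_zero hy
      refine ⟨u / cbrt y, by field_simp, ?_⟩
      field_simp; linarith
  · rintro ⟨r, rfl, rfl⟩
    have h4 : x * (r * cbrt y) ^ 3 + y * (-(r * cbrt x)) ^ 3 =
      r ^ 3 * (x * cbrt y ^ 3 - y * cbrt x ^ 3) := by ring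
    rw [h4, cbrt_pow_three, cbrt_pow_three]; ring

namespace OrientedSurface.PrincipalFrame

theorem push_V {M : Type*} [TopologicalSpace M] [ChartedSpace (EuclideanSpace ℝ (Fin 2)) M]
    {S : OrientedSurface M} (F : S.PrincipalFrame) (p : M) : S.push p (F.V p) =
    cbrt (F.θ₂ p) • S.push p (F.X₁ p) - cbrt (F.θ₁ p) • S.push p (F.X₂ p) := by
  unfold push V
  rw [map_sub, map_smul, map_smul]
  rfl

variable {M : Type*} [TopologicalSpace M] [ChartedSpace (EuclideanSpace ℝ (Fin 2)) M]
  [IsManifold (𝓡 2) ∞ M] {S : OrientedSurface M}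

theorem eq_of_smul_add_smul_eq (F : S.PrincipalFrame) {p : M} {a b c d : ℝ}
    (h : a • S.push p (F.X₁ p) + b • S.push p (F.X₂ p) =
      c • S.push p (F.X₁ p) + d • S.push p (F.X₂ p)) : a = c ∧ b = d := by
  obtain ⟨e11, e22, e12, e21⟩ := F.inner_frame p
  have h1 := congrArg (fun z => inner ℝ (S.push p (F.X₁ p)) z) h
  have h2 := congrArg (fun z => inner ℝ (S.push p (F.X₂ p)) z) h
  simp only [inner_add_right, inner_smul_right, e11, e12, e21, e22] at h1 h2
  constructor <;> linarith

theorem nonPrincipalAt_iff (F : S.PrincipalFrame) {γ : ℝ → M} {t u w : ℝ}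
    (hv : S.vel γ t = u • S.push (γ t) (F.X₁ (γ t)) + w • S.push (γ t) (F.X₂ (γ t))) :
    F.NonPrincipalAt γ t ↔ u ≠ 0 ∧ w ≠ 0 := by
  constructor
  · intro h
    constructor
    · rintro rfl
      exact (h w).2 (by rw [hv, zero_smul, zero_add])
    · rintro rfl
      exact (h u).1 (by rw [hv, zero_smul, add_zero])
  · rintro ⟨hu, hw⟩ r
    rw [hv]
    constructor
    · intro h
      exact hw (F.eq_of_smul_add_smul_eq (c := r) (d := 0) (by rw [h, zero_smul, add_zero])).2
    · intro h
      exact hu (F.eq_of_smul_add_smul_eq (c := 0) (d := r) (by rw [h, zero_smul, zero_add])).1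

/-- The differential equation of Darboux lines, in terms of the components of the velocity. -/
theorem darboux_iff (F : S.PrincipalFrame) {γ : ℝ → M} {J : Set ℝ} (hJ : IsOpen J)
    (hγ : ContMDiffOn 𝓘(ℝ, ℝ) (𝓡 2) ∞ γ J) {u w : ℝ → ℝ} {t u' w' : ℝ} (ht : t ∈ J)
    (hv : ∀ s ∈ J, S.vel γ s =
      u s • S.push (γ s) (F.X₁ (γ s)) + w s • S.push (γ s) (F.X₂ (γ s)))
    (hu : HasDerivAt u u' t) (hw : HasDerivAt w w' t) (h0 : u t ^ 2 + w t ^ 2 ≠ 0) :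
    (∃ σ : GenSphere, σ.Osculates (S.ι ∘ γ) t ∧ S.TangentSphere σ (γ t)) ↔
      6 * u t * w t * (u t * w' - w t * u') = F.μ (γ t) * (u t ^ 2 + w t ^ 2) *
        (F.θ₁ (γ t) * u t ^ 3 + F.θ₂ (γ t) * w t ^ 3) := by
  set e := extChartAt (𝓡 2) (γ t) with he
  have hγt : ContMDiffAt 𝓘(ℝ, ℝ) (𝓡 2) ∞ γ t := hγ.contMDiffAt (hJ.mem_nhds ht)
  have hsrc : ∀ᶠ s in 𝓝 t, γ s ∈ e.source :=
    hγt.continuousAt.eventually (extChartAt_source_mem_nhds (I := 𝓡 2) (γ t))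
  have hJt : ∀ᶠ s in 𝓝 t, s ∈ J := hJ.mem_nhds ht
  set q : ℝ → EuclideanSpace ℝ (Fin 2) := fun s => e (γ s) with hq
  have hqs : ContDiffAt ℝ ∞ q t :=
    ((contMDiffAt_extChartAt (I := 𝓡 2) (x := γ t)).comp t hγt).contDiffAt
  have hqt : q t ∈ e.target := mem_extChartAt_target (I := 𝓡 2) (γ t)
  have hqd : ∀ᶠ s in 𝓝 t, HasDerivAt q
      (u s • chartVec (γ t) (q s) (F.X₁ (e.symm (q s))) +
        w s • chartVec (γ t) (q s) (F.X₂ (e.symm (q s)))) s := by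
    filter_upwards [hsrc, hJt] with s hs hsJ
    have hes : e.symm (q s) = γ s := e.left_inv hs
    have hqs : q s ∈ e.target := e.map_source hs
    have hd : MDifferentiableAt (𝓡 2) 𝓘(ℝ, EuclideanSpace ℝ (Fin 2)) e (γ s) := by
      rw [← hes]; exact mdifferentiableAt_chart hqs
    have h1 := S.hasDerivAt_comp_curve
      (v := u s • F.X₁ (γ s) + w s • F.X₂ (γ s))
      ((hγ.contMDiffAt (hJ.mem_nhds hsJ)).mdifferentiableAt (by simp))
      (by rw [hv s hsJ]; unfold push; rw [map_add, map_smul, map_smul]; rfl) hd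
    refine h1.congr_deriv ?_
    rw [map_add, map_smul, map_smul]
    let G : ∀ X : (∀ m : M, TangentSpace (𝓡 2) m), M → EuclideanSpace ℝ (Fin 2) := fun X m =>
      mfderiv (𝓡 2) 𝓘(ℝ, EuclideanSpace ℝ (Fin 2)) e m (X m)
    change u s • G F.X₁ (γ s) + w s • G F.X₂ (γ s) =
      u s • G F.X₁ (e.symm (q s)) + w s • G F.X₂ (e.symm (q s))
    rw [hes]
  have het : e.symm (q t) = γ t := e.left_inv (mem_extChartAt_source (I := 𝓡 2) (γ t))
  have hcurve : S.ι ∘ γ =ᶠ[𝓝 t] (S.ι ∘ e.symm) ∘ q := by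
    filter_upwards [hsrc] with s hs
    simp [hq, e.left_inv hs]
  have key := (F.isPrincipalPatch (γ t)).darboux_iff hqs hqt hqd hu hw h0
  rw [F.fderiv_k₁_chart hqt, F.fderiv_k₂_chart hqt] at key
  simp only [Function.comp_apply] at key
  have hosc : ∀ σ : GenSphere, σ.Osculates (S.ι ∘ γ) t ↔ σ.Osculates ((S.ι ∘ e.symm) ∘ q) t := by
    intro σ
    refine forall₂_congr fun j _ => ?_
    rw [(hcurve.fun_comp σ.eqn).iteratedDeriv_eq j]
  have htan : ∀ σ : GenSphere, S.TangentSphere σ (γ t) ↔ S.TangentSphere σ (e.symm (q t)) := by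
    intro σ; rw [het]
  have hex : (∃ σ : GenSphere, σ.Osculates (S.ι ∘ γ) t ∧ S.TangentSphere σ (γ t)) ↔ _ :=
    exists_congr fun σ => and_congr (hosc σ) ((htan σ).trans (S.tangentSphere_chart_iff σ hqt))
  refine hex.trans (key.trans ?_)
  rw [← he, het, F.dirDeriv_k₁, F.dirDeriv_k₂]
  have hμ := (F.μ_pos (γ t))
  have hk : F.k₁ (γ t) - F.k₂ (γ t) = 2 * F.μ (γ t) := by unfold μ; ring
  rw [hk]
  constructor
  · intro h
    apply mul_left_cancel₀ hμ.ne'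
    linear_combination h
  · intro h
    linear_combination F.μ (γ t) * h

/-- Components of the velocity of a curve in the principal frame. -/
theorem exists_components (F : S.PrincipalFrame) {γ : ℝ → M} {J : Set ℝ} (hJ : IsOpen J)
    (hγ : ContMDiffOn 𝓘(ℝ, ℝ) (𝓡 2) ∞ γ J) :
    ∃ u w : ℝ → ℝ, DifferentiableOn ℝ u J ∧ DifferentiableOn ℝ w J ∧
      ∀ s ∈ J, S.vel γ s = u s • S.push (γ s) (F.X₁ (γ s)) + w s • S.push (γ s) (F.X₂ (γ s)) := by
  have hvel : DifferentiableOn ℝ (S.vel γ) J := by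
    have h1 : ContDiffOn ℝ ∞ (S.ι ∘ γ) J := (S.smooth_ι.comp_contMDiffOn hγ).contDiffOn
    exact ((contDiffOn_infty_iff_deriv_of_isOpen hJ).1 h1).2.differentiableOn (by simp)
  have h1 : DifferentiableOn ℝ (fun s => S.push (γ s) (F.X₁ (γ s))) J :=
    ((F.smooth_X₁.comp_contMDiffOn hγ).contDiffOn).differentiableOn (by simp)
  have h2 : DifferentiableOn ℝ (fun s => S.push (γ s) (F.X₂ (γ s))) J :=
    ((F.smooth_X₂.comp_contMDiffOn hγ).contDiffOn).differentiableOn (by simp)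
  refine ⟨_, _, h1.inner ℝ hvel, h2.inner ℝ hvel, fun s hs => ?_⟩
  rw [S.vel_eq_push ((hγ.contMDiffAt (hJ.mem_nhds hs)).mdifferentiableAt (by simp))]
  exact F.push_eq _ _

theorem angleAlong_eq (F : S.PrincipalFrame) {γ : ℝ → M} {t u w : ℝ}
    (hv : S.vel γ t = u • S.push (γ t) (F.X₁ (γ t)) + w • S.push (γ t) (F.X₂ (γ t))) :
    S.angleAlong F.X₁ γ t = Real.arccos (u / √(u ^ 2 + w ^ 2)) ∧
    S.angleAlong F.X₂ γ t = Real.arccos (w / √(w ^ 2 + u ^ 2)) := by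
  obtain ⟨e11, e22, e12, e21⟩ := F.inner_frame (γ t)
  have hn : ‖S.vel γ t‖ = √(u ^ 2 + w ^ 2) := by
    rw [norm_eq_sqrt_real_inner, hv]
    simp only [inner_add_right, inner_add_left, inner_smul_right, inner_smul_left, e11, e12, e21,
      e22, conj_trivial]
    congr 1; ring
  unfold angleAlong InnerProductGeometry.angle
  rw [hn, F.unit_X₁, F.unit_X₂, hv, add_comm (w ^ 2)]
  simp only [inner_add_left, inner_smul_left, e11, e12, e21, e22, conj_trivial]
  simp

/-- A Dupin line is tangent to a curve with velocity components `u`, `w` exactly if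
`θ₁ u ^ 3 + θ₂ w ^ 3 = 0`. -/
theorem tangentAt_iff (F : S.PrincipalFrame) (hF : F.NoDupinPoints) {δ : ℝ → M} {K : Set ℝ}
    (hδ : F.IsDupinLine δ K) {γ : ℝ → M} {s t u w : ℝ} (hs : s ∈ K) (hst : δ s = γ t)
    (hv : S.vel γ t = u • S.push (γ t) (F.X₁ (γ t)) + w • S.push (γ t) (F.X₂ (γ t)))
    (hu : u ≠ 0) :
    S.TangentAt δ γ s t ↔ F.θ₁ (γ t) * u ^ 3 + F.θ₂ (γ t) * w ^ 3 = 0 := by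
  obtain ⟨r, hr⟩ := hδ.2 s hs
  have hr0 : r ≠ 0 := by
    rintro rfl
    exact hδ.1.2.2.2 s hs (by rw [hr, zero_smul])
  rw [cbrt_direction_iff (hF (γ t))]
  have hδv : S.vel δ s = r • (cbrt (F.θ₂ (γ t)) • S.push (γ t) (F.X₁ (γ t)) -
      cbrt (F.θ₁ (γ t)) • S.push (γ t) (F.X₂ (γ t))) := by
    rw [hr, F.push_V, hst]
  constructor
  · rintro ⟨-, c, -, hc⟩
    rw [hv, hδv] at hc
    obtain ⟨h1, h2⟩ := F.eq_of_smul_add_smul_eq (c := c * r * cbrt (F.θ₂ (γ t)))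
      (d := -(c * r * cbrt (F.θ₁ (γ t)))) (by rw [hc]; module)
    exact ⟨c * r, h1, h2⟩
  · rintro ⟨c, h1, h2⟩
    refine ⟨hst, c / r, ?_, ?_⟩
    · refine div_ne_zero ?_ hr0
      rintro rfl
      exact hu (by rw [h1, zero_mul])
    · rw [hv, hδv, smul_smul, div_mul_cancel₀ _ hr0, h1, h2]
      module

end OrientedSurface.PrincipalFrame

namespace OrientedSurface.PrincipalFrame

variable {M : Type*} [TopologicalSpace M] [ChartedSpace (EuclideanSpace ℝ (Fin 2)) M]
  [IsManifold (𝓡 2) ∞ M] {S : OrientedSurface M}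

theorem vel_chart_symm (S : OrientedSurface M) {p : M} {q : ℝ → EuclideanSpace ℝ (Fin 2)} {t : ℝ}
    (hx : q t ∈ (extChartAt (𝓡 2) p).target)
    {v : TangentSpace (𝓡 2) ((extChartAt (𝓡 2) p).symm (q t))}
    (hq : HasDerivAt q (chartVec p (q t) v) t) :
    S.vel (fun s => (extChartAt (𝓡 2) p).symm (q s)) t =
      S.push ((extChartAt (𝓡 2) p).symm (q t)) v := by
  rw [← push_chartVec S hx]
  have hd := differentiableAt_comp_chart_symm hx (S.smooth_ι.mdifferentiable (by simp) _)
  exact (hd.hasFDerivAt.comp_hasDerivAt t hq).deriv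

/-- Through every point with `θ₁ θ₂ ≠ 0` there passes a Dupin line. -/
theorem exists_isDupinLine (F : S.PrincipalFrame) {p : M} (h₁ : F.θ₁ p ≠ 0) (h₂ : F.θ₂ p ≠ 0) :
    ∃ (δ : ℝ → M) (K : Set ℝ) (s₀ : ℝ), F.IsDupinLine δ K ∧ s₀ ∈ K ∧ δ s₀ = p := by
  set e := extChartAt (𝓡 2) p with he
  have hp := F.isPrincipalPatch p
  have ho₁ := (F.contDiffOn_θ₁_chart p).continuousOn.isOpen_inter_preimage hp.isOpen
    (isOpen_compl_singleton (x := (0 : ℝ)))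
  set Ω₁ := (extChartAt (𝓡 2) p).target ∩ F.θ₁ ∘ (extChartAt (𝓡 2) p).symm ⁻¹' {0}ᶜ with hΩ₁
  have ho := ((F.contDiffOn_θ₂_chart p).mono inter_subset_left).continuousOn.isOpen_inter_preimage
    ho₁ (isOpen_compl_singleton (x := (0 : ℝ)))
  set Ω := Ω₁ ∩ F.θ₂ ∘ (extChartAt (𝓡 2) p).symm ⁻¹' {0}ᶜ with hΩ
  have hsub : Ω ⊆ e.target := fun x hx => hx.1.1
  have hc₁ : ContDiffOn ℝ ∞ (fun x => cbrt (F.θ₁ (e.symm x))) Ω := fun x hx =>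
    ContDiffAt.comp_contDiffWithinAt (g := cbrt) (f := fun x => F.θ₁ (e.symm x)) x
      (contDiffAt_cbrt hx.1.2)
      ((F.contDiffOn_θ₁_chart p).mono hsub x hx)
  have hc₂ : ContDiffOn ℝ ∞ (fun x => cbrt (F.θ₂ (e.symm x))) Ω := fun x hx =>
    ContDiffAt.comp_contDiffWithinAt (g := cbrt) (f := fun x => F.θ₂ (e.symm x)) x
      (contDiffAt_cbrt hx.2)
      ((F.contDiffOn_θ₂_chart p).mono hsub x hx)
  have hf : ContDiffOn ℝ ∞ (fun x => chartVec p x (F.V (e.symm x))) Ω := by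
    refine ((hc₂.smul (hp.smooth_a₁.mono hsub)).sub (hc₁.smul (hp.smooth_a₂.mono hsub))).congr
      fun x hx => ?_
    unfold chartVec V
    rw [map_sub, map_smul, map_smul]
    rfl
  have hpt : e.symm (e p) = p := extChartAt_to_inv p
  have hx : e p ∈ Ω := ⟨⟨mem_extChartAt_target p,
    show F.θ₁ (e.symm (e p)) ≠ 0 by rwa [hpt]⟩, show F.θ₂ (e.symm (e p)) ≠ 0 by rwa [hpt]⟩
  obtain ⟨q, K, hK, hKc, h0, hq0, hq, hqs⟩ := exists_smooth_integralCurve ho hf hx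
  have hvel : ∀ s ∈ K, S.vel (fun s => e.symm (q s)) s =
      S.push (e.symm (q s)) (F.V (e.symm (q s))) :=
    fun s hs => vel_chart_symm S (hsub (hq s hs).1) (hq s hs).2
  refine ⟨fun s => e.symm (q s), K, 0,
    ⟨⟨hK, hKc, ?_, fun s hs h => ?_⟩, fun s hs => ⟨1, ?_⟩⟩, h0, ?_⟩
  · exact ((contMDiffOn_extChartAt_symm (n := ∞) p).comp hqs.contMDiffOn
      fun s hs => hsub (hq s hs).1).of_le (WithTop.coe_le_coe.2 le_top)
  · rw [hvel s hs, F.push_V] at h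
    refine cbrt_ne_zero (show F.θ₂ (e.symm (q s)) ≠ 0 from (hq s hs).1.2)
      (F.eq_of_smul_add_smul_eq (p := e.symm (q s)) (b := -cbrt (F.θ₁ (e.symm (q s))))
        (c := 0) (d := 0) ?_).1
    rw [neg_smul, ← sub_eq_add_neg, h]; simp
  · rw [hvel s hs, one_smul]
  · simp only [hq0, hpt]

/-- Darboux lines exist in every direction that is not principal. -/
theorem exists_isDarbouxLine (F : S.PrincipalFrame) (p : M) {m₀ : ℝ} (hm₀ : m₀ ≠ 0) :
    ∃ (γ : ℝ → M) (J : Set ℝ), S.IsDarbouxLine γ J ∧ (0 : ℝ) ∈ J ∧ γ 0 = p ∧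
      S.vel γ 0 = (1 : ℝ) • S.push (γ 0) (F.X₁ (γ 0)) + m₀ • S.push (γ 0) (F.X₂ (γ 0)) := by
  set e := extChartAt (𝓡 2) p with he
  have hp := F.isPrincipalPatch p
  set Ω : Set (EuclideanSpace ℝ (Fin 2) × ℝ) := e.target ×ˢ {0}ᶜ with hΩ
  have ho : IsOpen Ω := hp.isOpen.prod isOpen_compl_singleton
  have hfst : ∀ {W : Type} [NormedAddCommGroup W] [NormedSpace ℝ W]
      {g : EuclideanSpace ℝ (Fin 2) → W}, ContDiffOn ℝ ∞ g e.target →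
      ContDiffOn ℝ ∞ (fun z : EuclideanSpace ℝ (Fin 2) × ℝ => g z.1) Ω :=
    fun hg => hg.comp contDiffOn_fst fun z hz => hz.1
  let f : EuclideanSpace ℝ (Fin 2) × ℝ → EuclideanSpace ℝ (Fin 2) × ℝ := fun z =>
    (chartVec p z.1 (F.X₁ (e.symm z.1)) + z.2 • chartVec p z.1 (F.X₂ (e.symm z.1)),
      F.μ (e.symm z.1) * (1 + z.2 ^ 2) * (F.θ₁ (e.symm z.1) + F.θ₂ (e.symm z.1) * z.2 ^ 3) /
        (6 * z.2))
  have hsnd : ContDiffOn ℝ ∞ (fun z : EuclideanSpace ℝ (Fin 2) × ℝ => z.2) Ω := contDiffOn_snd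
  have hf : ContDiffOn ℝ ∞ f Ω := by
    refine ContDiffOn.prodMk ((hfst hp.smooth_a₁).add (hsnd.smul (hfst hp.smooth_a₂))) ?_
    refine ContDiffOn.div ?_ (contDiffOn_const.mul hsnd)
      fun z hz => mul_ne_zero (by norm_num) hz.2
    exact ((hfst (F.contDiffOn_μ_chart p)).mul (contDiffOn_const.add (hsnd.pow 2))).mul
      ((hfst (F.contDiffOn_θ₁_chart p)).add ((hfst (F.contDiffOn_θ₂_chart p)).mul (hsnd.pow 3)))
  have hpt : e.symm (e p) = p := extChartAt_to_inv p
  obtain ⟨z, J, hJ, hJc, h0, hz0, hz, hzs⟩ := exists_smooth_integralCurve ho hf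
    (x := (e p, m₀)) ⟨mem_extChartAt_target p, hm₀⟩
  set γ : ℝ → M := fun s => e.symm (z s).1 with hγ
  have hq : ∀ s ∈ J, HasDerivAt (fun s => (z s).1) (chartVec p (z s).1
      ((1 : ℝ) • F.X₁ (e.symm (z s).1) + (z s).2 • F.X₂ (e.symm (z s).1))) s := by
    intro s hs
    refine (hasFDerivAt_fst.comp_hasDerivAt s (hz s hs).2).congr_deriv ?_
    unfold chartVec
    rw [map_add, map_smul, map_smul, one_smul]
    rfl
  have hm : ∀ s ∈ J, HasDerivAt (fun s => (z s).2) (F.μ (γ s) * (1 + (z s).2 ^ 2) *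
      (F.θ₁ (γ s) + F.θ₂ (γ s) * (z s).2 ^ 3) / (6 * (z s).2)) s := fun s hs =>
    (hasFDerivAt_snd.comp_hasDerivAt s (hz s hs).2).congr_deriv rfl
  have hvel : ∀ s ∈ J, S.vel γ s = (1 : ℝ) • S.push (γ s) (F.X₁ (γ s)) +
      (z s).2 • S.push (γ s) (F.X₂ (γ s)) := by
    intro s hs
    have := vel_chart_symm S (q := fun s => (z s).1) (hz s hs).1.1 (hq s hs)
    refine this.trans ?_
    unfold push
    rw [map_add, map_smul, map_smul]
    rfl
  have hγs : ContMDiffOn 𝓘(ℝ, ℝ) (𝓡 2) ∞ γ J :=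
    (contMDiffOn_extChartAt_symm (n := ∞) p).comp
      (contDiff_fst.comp_contDiffOn hzs).contMDiffOn fun s hs => (hz s hs).1.1
  refine ⟨γ, J, ⟨⟨hJ, hJc, hγs, fun s hs h => ?_⟩, fun s hs => ?_⟩, h0, ?_, ?_⟩
  · rw [hvel s hs] at h
    exact one_ne_zero (F.eq_of_smul_add_smul_eq (p := γ s) (c := 0) (d := 0) (by rw [h]; simp)).1
  · refine (F.darboux_iff hJ hγs (u := fun _ => 1) (w := fun s => (z s).2) hs hvel
      (hasDerivAt_const s 1) (hm s hs) (by positivity)).2 ?_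
    have : (z s).2 ≠ 0 := (hz s hs).1.2
    field_simp
    ring
  · simp only [hγ, hz0, hpt]
  · have := hvel 0 h0
    rwa [hz0] at this

/-- The angle between a Darboux line and a principal direction, at a common point of the Darboux
line and a Dupin line. -/
theorem angle_critical (F : S.PrincipalFrame) (hF : F.NoDupinPoints) {δ : ℝ → M} {K : Set ℝ}
    (hδ : F.IsDupinLine δ K) {γ : ℝ → M} {J : Set ℝ} (hγ : S.IsDarbouxLine γ J) {s₀ t₀ : ℝ}
    (hs₀ : s₀ ∈ K) (ht₀ : t₀ ∈ J) (hst : δ s₀ = γ t₀) (hnp : F.NonPrincipalAt γ t₀)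
    {X : ∀ p : M, TangentSpace (𝓡 2) p} (hX : X = F.X₁ ∨ X = F.X₂) :
    (S.TangentAt δ γ s₀ t₀ ↔ HasDerivAt (S.angleAlong X γ) 0 t₀) ∧
      (S.TangentAt δ γ s₀ t₀ →
        dirDeriv F.V (fun q => Real.log |F.θ₁ q| - Real.log |F.θ₂ q|) (γ t₀) ≠ 0 →
        IsStrictLocalExtremum (S.angleAlong X γ) t₀) := by
  obtain ⟨⟨hJ, -, hγs, -⟩, hdar⟩ := hγ
  obtain ⟨u, w, hu, hw, hv⟩ := F.exists_components hJ hγs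
  obtain ⟨hu0, hw0⟩ := (F.nonPrincipalAt_iff (hv t₀ ht₀)).1 hnp
  have hJt : ∀ᶠ s in 𝓝 t₀, s ∈ J := hJ.mem_nhds ht₀
  have hud : ∀ᶠ s in 𝓝 t₀, DifferentiableAt ℝ u s := by
    filter_upwards [hJt] with s hs using hu.differentiableAt (hJ.mem_nhds hs)
  have hwd : ∀ᶠ s in 𝓝 t₀, DifferentiableAt ℝ w s := by
    filter_upwards [hJt] with s hs using hw.differentiableAt (hJ.mem_nhds hs)
  have hut := hud.self_of_nhds
  have hwt := hwd.self_of_nhds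
  set g : ℝ → ℝ := fun s => F.θ₁ (γ s) * u s ^ 3 + F.θ₂ (γ s) * w s ^ 3 with hg
  have heq : ∀ᶠ s in 𝓝 t₀, 6 * u s * w s * (u s * deriv w s - w s * deriv u s) =
      F.μ (γ s) * (u s ^ 2 + w s ^ 2) * g s := by
    filter_upwards [hJt, hud, hwd, hut.continuousAt.eventually_ne hu0] with s hs hus hws hne
    exact (F.darboux_iff hJ hγs hs hv hus.hasDerivAt hws.hasDerivAt (by positivity)).1 (hdar s hs)
  have htan := F.tangentAt_iff hF hδ hs₀ hst (hv t₀ ht₀) hu0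
  have hγt : MDifferentiableAt 𝓘(ℝ, ℝ) (𝓡 2) γ t₀ :=
    (hγs.contMDiffAt (hJ.mem_nhds ht₀)).mdifferentiableAt (by simp)
  have hμ0 := (F.μ_pos (γ t₀)).ne'
  have hvt : S.vel γ t₀ = S.push (γ t₀) (u t₀ • F.X₁ (γ t₀) + w t₀ • F.X₂ (γ t₀)) := by
    rw [hv t₀ ht₀]; unfold push; rw [map_add, map_smul, map_smul]; rfl
  have hμd : DifferentiableAt ℝ (fun s => F.μ (γ s)) t₀ :=
    (S.hasDerivAt_comp_curve hγt hvt (F.mdifferentiable_μ _)).differentiableAt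
  have hd₁ := S.hasDerivAt_comp_curve hγt hvt (F.mdifferentiable_θ₁ _)
  have hd₂ := S.hasDerivAt_comp_curve hγt hvt (F.mdifferentiable_θ₂ _)
  set c₁ : ℝ := mfderiv (𝓡 2) 𝓘(ℝ, ℝ) F.θ₁ (γ t₀) (u t₀ • F.X₁ (γ t₀) + w t₀ • F.X₂ (γ t₀))
  set c₂ : ℝ := mfderiv (𝓡 2) 𝓘(ℝ, ℝ) F.θ₂ (γ t₀) (u t₀ • F.X₁ (γ t₀) + w t₀ • F.X₂ (γ t₀))
  have hgd : HasDerivAt g ((c₁ * u t₀ ^ 3 + F.θ₁ (γ t₀) * (3 * u t₀ ^ 2 * deriv u t₀)) +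
      (c₂ * w t₀ ^ 3 + F.θ₂ (γ t₀) * (3 * w t₀ ^ 2 * deriv w t₀))) t₀ := by
    have := (hd₁.mul (hut.hasDerivAt.pow 3)).add (hd₂.mul (hwt.hasDerivAt.pow 3))
    exact this.congr_deriv (by simp)
  have hgne : g t₀ = 0 →
      dirDeriv F.V (fun q => Real.log |F.θ₁ q| - Real.log |F.θ₂ q|) (γ t₀) ≠ 0 →
      (c₁ * u t₀ ^ 3 + F.θ₁ (γ t₀) * (3 * u t₀ ^ 2 * deriv u t₀)) +
        (c₂ * w t₀ ^ 3 + F.θ₂ (γ t₀) * (3 * w t₀ ^ 2 * deriv w t₀)) ≠ 0 := by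
    intro hg0 hdir hzero
    apply hdir
    have h₁ : F.θ₁ (γ t₀) ≠ 0 := by
      intro h
      rcases hF (γ t₀) with h' | h'
      · exact h' h
      · have : F.θ₂ (γ t₀) * w t₀ ^ 3 = 0 := by simpa [hg, h] using hg0
        exact mul_ne_zero h' (pow_ne_zero 3 hw0) this
    have h₂ : F.θ₂ (γ t₀) ≠ 0 := by
      intro h
      have : F.θ₁ (γ t₀) * u t₀ ^ 3 = 0 := by simpa [hg, h] using hg0
      exact mul_ne_zero h₁ (pow_ne_zero 3 hu0) this
    obtain ⟨r, hr₁, hr₂⟩ := (cbrt_direction_iff (hF (γ t₀))).1 hg0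
    have hr0 : r ≠ 0 := by
      rintro rfl
      exact hu0 (by rw [hr₁, zero_mul])
    have hvr : u t₀ • F.X₁ (γ t₀) + w t₀ • F.X₂ (γ t₀) = r • F.V (γ t₀) := by
      rw [hr₁, hr₂]; unfold V; module
    have hlog : HasDerivAt (fun s => Real.log |F.θ₁ (γ s)| - Real.log |F.θ₂ (γ s)|)
        (c₁ / F.θ₁ (γ t₀) - c₂ / F.θ₂ (γ t₀)) t₀ := by
      simp only [Real.log_abs]
      exact (hd₁.log h₁).sub (hd₂.log h₂)
    have hmd : MDifferentiableAt (𝓡 2) 𝓘(ℝ, ℝ)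
        (fun q => Real.log |F.θ₁ q| - Real.log |F.θ₂ q|) (γ t₀) := by
      simp only [Real.log_abs]
      exact ((Real.differentiableAt_log h₁).mdifferentiableAt.comp (γ t₀)
        (F.mdifferentiable_θ₁ _)).sub
        ((Real.differentiableAt_log h₂).mdifferentiableAt.comp (γ t₀) (F.mdifferentiable_θ₂ _))
    have huniq := (S.hasDerivAt_comp_curve hγt hvt hmd).unique hlog
    rw [hvr, map_smul] at huniq
    have hD : u t₀ * deriv w t₀ - w t₀ * deriv u t₀ = 0 := by
      have := heq.self_of_nhds
      rw [hg0, mul_zero] at this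
      exact (mul_eq_zero.1 this).resolve_left (by positivity)
    have hg0' : F.θ₁ (γ t₀) * u t₀ ^ 3 + F.θ₂ (γ t₀) * w t₀ ^ 3 = 0 := hg0
    have hc : c₁ * u t₀ ^ 3 + c₂ * w t₀ ^ 3 = 0 := by
      apply mul_left_cancel₀ hu0
      linear_combination u t₀ * hzero - 3 * deriv u t₀ * hg0' -
        3 * F.θ₂ (γ t₀) * w t₀ ^ 2 * hD
    have hcc : c₁ / F.θ₁ (γ t₀) - c₂ / F.θ₂ (γ t₀) = 0 := by
      rw [sub_eq_zero, div_eq_div_iff h₁ h₂]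
      apply mul_right_cancel₀ (pow_ne_zero 3 hu0)
      linear_combination F.θ₂ (γ t₀) * hc - c₂ * hg0'
    rw [hcc] at huniq
    exact (mul_eq_zero.1 huniq).resolve_left hr0
  rcases hX with rfl | rfl
  · obtain ⟨k1, k2⟩ := arccos_div_sqrt_critical (f := S.angleAlong F.X₁ γ) (g := g)
      (m := fun s => F.μ (γ s)) (hJt.mono fun s hs => (F.angleAlong_eq (hv s hs)).1)
      hud hwd hu0 hw0 hμ0 hμd heq
    exact ⟨htan.trans k1.symm, fun ht hdir =>
      k2 _ (htan.1 ht) hgd (hgne (htan.1 ht) hdir)⟩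
  · obtain ⟨k1, k2⟩ := arccos_div_sqrt_critical (f := S.angleAlong F.X₂ γ) (g := fun s => -g s)
      (m := fun s => F.μ (γ s)) (hJt.mono fun s hs => (F.angleAlong_eq (hv s hs)).2)
      hwd hud hw0 hu0 hμ0 hμd (heq.mono fun s hs => by linear_combination -hs)
    refine ⟨htan.trans (k1.trans neg_eq_zero).symm, fun ht hdir =>
      k2 _ (neg_eq_zero.2 (htan.1 ht)) hgd.neg (neg_ne_zero.2 (hgne (htan.1 ht) hdir))⟩

end OrientedSurface.PrincipalFrame

theorem proposition1 {M : Type*} [TopologicalSpace M]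
    [ChartedSpace (EuclideanSpace ℝ (Fin 2)) M] [IsManifold (𝓡 2) ∞ M]
    (S : OrientedSurface M) (F : S.PrincipalFrame) (hF : F.NoDupinPoints) :
    -- through every non-canal point there passes a leaf of the Dupin foliation
    (∀ p : M, F.θ₁ p ≠ 0 → F.θ₂ p ≠ 0 →
      ∃ (δ : ℝ → M) (K : Set ℝ) (s₀ : ℝ), F.IsDupinLine δ K ∧ s₀ ∈ K ∧ δ s₀ = p) ∧
    -- at every non-canal point of it, a leaf is tangent to some Darboux line
    (∀ (δ : ℝ → M) (K : Set ℝ), F.IsDupinLine δ K →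
      ∀ s₀ ∈ K, F.θ₁ (δ s₀) ≠ 0 → F.θ₂ (δ s₀) ≠ 0 →
        ∃ (γ : ℝ → M) (J : Set ℝ) (t₀ : ℝ),
          S.IsDarbouxLine γ J ∧ t₀ ∈ J ∧ F.NonPrincipalAt γ t₀ ∧ S.TangentAt δ γ s₀ t₀) ∧
    -- where a leaf meets a Darboux line in a direction that is not principal, they are tangent
    -- exactly when the point is critical for the angle between the Darboux line and the principal
    -- directions; under the genericity condition this angle has a local extremum there
    (∀ (δ : ℝ → M) (K : Set ℝ), F.IsDupinLine δ K →
      ∀ (γ : ℝ → M) (J : Set ℝ), S.IsDarbouxLine γ J →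
      ∀ s₀ ∈ K, ∀ t₀ ∈ J, δ s₀ = γ t₀ → F.NonPrincipalAt γ t₀ →
      ∀ X : (∀ p : M, TangentSpace (𝓡 2) p), X = F.X₁ ∨ X = F.X₂ →
        (S.TangentAt δ γ s₀ t₀ ↔ HasDerivAt (S.angleAlong X γ) 0 t₀) ∧
        (S.TangentAt δ γ s₀ t₀ →
          dirDeriv F.V (fun q => Real.log |F.θ₁ q| - Real.log |F.θ₂ q|) (γ t₀) ≠ 0 →
          IsStrictLocalExtremum (S.angleAlong X γ) t₀)) := by
  refine ⟨fun p h₁ h₂ => F.exists_isDupinLine h₁ h₂, fun δ K hδ s₀ hs₀ h₁ h₂ => ?_,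
    fun δ K hδ γ J hγ s₀ hs₀ t₀ ht₀ hst hnp X hX =>
      F.angle_critical hF hδ hγ hs₀ ht₀ hst hnp hX⟩
  have hc₁ := cbrt_ne_zero h₁
  have hc₂ := cbrt_ne_zero h₂
  have hm : -(cbrt (F.θ₁ (δ s₀)) / cbrt (F.θ₂ (δ s₀))) ≠ 0 := neg_ne_zero.2 (div_ne_zero hc₁ hc₂)
  obtain ⟨γ, J, hγ, h0, hγ0, hvel⟩ := F.exists_isDarbouxLine (δ s₀) hm
  refine ⟨γ, J, 0, hγ, h0, (F.nonPrincipalAt_iff hvel).2 ⟨one_ne_zero, hm⟩, ?_⟩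
  rw [F.tangentAt_iff hF hδ hs₀ hγ0.symm hvel one_ne_zero, cbrt_direction_iff (hF (γ 0)), hγ0]
  exact ⟨1 / cbrt (F.θ₂ (δ s₀)), by field_simp, by field_simp⟩
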